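/- Let $d\ge 2$, $0<T<\infty$, and assume the following. - $\Psi:[0,\infty)\to[0,\infty)$ is a Bernstein function (continuous, $C^\infty$ on $(0,\infty)$, with $(-1)^{k-1}\Psi^{(k)}\ge 0$ on $(0,\infty)$ for $k\ge 1$) of the form $\Psi(r)=\int_{(0,\infty)}(1-e^{-rt})\,\mu(dt)$, $r\ge 0$, where $\mu$ is a positive measure on $(0,\infty)$ with $\int_{(0,\infty)}(1\wedge t)\,\mu(dt)<\infty$, and there are $s\in(\tfrac12,1)$ and $C\in(0,\infty)$ with $\Psi(r)\ge Cr^s$ for all $r\ge 0$. The operator $\Psi(-\Delta)$ is the Fourier multiplier on $\mathbb R^d$ with symbol $\Psi(|\xi|^2)$. - $\beta\in C^1(\mathbb R)$, $\beta(0)=0$, $D\in L^\infty(\mathbb R^d;\mathbb R^d)$, $b\in C^1(\mathbb R)$; and either $\beta'(r)>0$ for all $r\in\mathbb R$, or $D\equiv 0$ and $\beta'(r)\ge 0$ for all $r\in\mathbb R$. Let $u\in L^\infty((0,T)\times\mathbb R^d)$, let $u_0$ be a (signed) measure of finite variation on $\mathbb R^d$, and let $y_1,y_2\in L^\infty((0,T)\times\mathbb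 R^d)$ be two distributional solutions of $$y_t+\Psi(-\Delta)\Big(\frac{\beta(u)}{u}\,y\Big)+\operatorname{div}\big(y\,D\,b(u)\big)=0\ \text{ on }(0,T)\times\mathbb R^d,\qquad y(0)=u_0,$$ where $\frac{\beta(0)}{0}:=\beta'(0)$; that is, for $y=y_1$ and $y=y_2$ and all $\varphi\in C_0^\infty([0,T)\times\mathbb R^d)$, $$\int_0^T\!\!\int_{\mathbb R^d}\Big(y\,\varphi_t-\frac{\beta(u)}{u}\,y\,\Psi(-\Delta)\varphi+b(u)\,y\,D\cdot\nabla\varphi\Big)\,dx\,dt+\int_{\mathbb R^d}\varphi(0,x)\,u_0(dx)=0.$$ Suppose that $y_1-y_2\in L^1((0,T)\times\mathbb R^d)\cap L^\infty(0,T;L^2(\mathbb R^d))$ and that $$\lim_{t\to0}\ \operatorname*{ess\,sup}_{\sigma\in(0,t)}\Big|\int_{\mathbb R^d}\big(y_1(\sigma,x)-y_2(\sigma,x)\big)\psi(x)\,dx\Big|=0\qquad\text{for all }\psi\in C_0^\infty(\mathbb R^d).$$ Then $y_1=y_2$ a.e. on $(0,T)\times\mathbb R^d$. -/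

import Mathlib

open MeasureTheory Set Filter Topology
open scoped FourierTransform ENNReal

noncomputable section

/-- Bernstein functions on `[0, ∞)`: continuous, nonnegative, smooth on `(0, ∞)`, with
`(-1)^(k-1) Ψ^(k) ≥ 0` on `(0, ∞)` for `k ≥ 1`. Only the values of `Ψ` on `[0, ∞)` matter. -/
structure IsBernsteinFunction (Ψ : ℝ → ℝ) : Prop where
  continuousOn : ContinuousOn Ψ (Ici 0)
  nonneg : ∀ r, 0 ≤ r → 0 ≤ Ψ r
  contDiffOn : ContDiffOn ℝ (⊤ : ℕ∞) Ψ (Ioi 0)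
  alternating : ∀ k : ℕ, ∀ r, 0 < r → 0 ≤ (-1 : ℝ) ^ k * iteratedDeriv (k + 1) Ψ r

/-- `Ψ(r) = a₁ + a₂ r + ∫_{(0,∞)} (1 - e^{-rt}) μ(dt)` for `r ≥ 0`, where `a₁, a₂ ≥ 0` and
`∫_{(0,∞)} (1 ∧ t) μ(dt) < ∞`. Only the restriction of `μ` to `(0, ∞)` matters. -/
structure HasLevyKhintchineRepr (Ψ : ℝ → ℝ) (a₁ a₂ : ℝ) (μ : Measure ℝ) : Prop where
  nonneg_const : 0 ≤ a₁
  nonneg_drift : 0 ≤ a₂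
  finite : ∫⁻ t in Ioi 0, ENNReal.ofReal (min 1 t) ∂μ < ∞
  eq : ∀ r, 0 ≤ r → Ψ r = a₁ + a₂ * r + ∫ t in Ioi 0, (1 - Real.exp (-(r * t))) ∂μ

/-- The operator `Ψ(-Δ)` on `C_c^∞(ℝ^d)`: the Fourier multiplier with symbol `Ψ(|ξ|²)`.
Since `𝓕 f ξ = ∫ e^{-2πi ⟨x, ξ⟩} f(x) dx` here, the symbol reads `Ψ(|2πξ|²)` in the variable of `𝓕`.
The symbol is even and `f` is real, so the inverse transform is real and `re` loses nothing. -/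
def psiLaplacian {d : ℕ} (Ψ : ℝ → ℝ) (f : EuclideanSpace ℝ (Fin d) → ℝ)
    (x : EuclideanSpace ℝ (Fin d)) : ℝ :=
  (𝓕⁻ (fun ξ : EuclideanSpace ℝ (Fin d) =>
    (Ψ ((2 * Real.pi * ‖ξ‖) ^ 2) : ℂ) *
      𝓕 (fun z : EuclideanSpace ℝ (Fin d) => (f z : ℂ)) ξ) x).re

/-- `r ↦ β(r)/r`, with the value `β'(0)` at `r = 0`. -/
def divSelf (β : ℝ → ℝ) (r : ℝ) : ℝ := if r = 0 then deriv β 0 else β r / r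

/-- Lebesgue measure on `(0, T) × ℝ^d`. -/
abbrev spaceTimeMeasure (d : ℕ) (T : ℝ) : Measure (ℝ × EuclideanSpace ℝ (Fin d)) :=
  (volume : Measure (ℝ × EuclideanSpace ℝ (Fin d))).restrict (Ioo 0 T ×ˢ univ)

/-- Test functions `C_0^∞([0, T) × ℝ^d)`, given as restrictions to `t ≥ 0` of smooth functions
on `ℝ × ℝ^d` with compact support in `(-∞, T) × ℝ^d`. -/
structure IsTestFunction {d : ℕ} (T : ℝ) (φ : ℝ × EuclideanSpace ℝ (Fin d) → ℝ) : Prop where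
  contDiff : ContDiff ℝ (⊤ : ℕ∞) φ
  hasCompactSupport : HasCompactSupport φ
  tsupport_subset : tsupport φ ⊆ Iio T ×ˢ univ

/-- Distributional solutions `y` on `(0, T) × ℝ^d` of the linear Cauchy problem
`y_t + Ψ(-Δ)((β(u)/u) y) + div(y D b(u)) = 0`, `y(0) = u₀`: for every test function `φ`,
`∫_{(0,T)×ℝ^d} (y φ_t - (β(u)/u) y Ψ(-Δ)φ + b(u) y D·∇φ) dt dx + ∫ φ(0, x) u₀(dx) = 0`.
The term `D·∇φ` is the derivative of `φ(t, ·)` at `x` in the direction `D x`. -/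
def IsLinearizedSolution {d : ℕ} (T : ℝ) (Ψ β b : ℝ → ℝ)
    (D : EuclideanSpace ℝ (Fin d) → EuclideanSpace ℝ (Fin d))
    (u : ℝ × EuclideanSpace ℝ (Fin d) → ℝ) (u₀ : SignedMeasure (EuclideanSpace ℝ (Fin d)))
    (y : ℝ × EuclideanSpace ℝ (Fin d) → ℝ) : Prop :=
  ∀ φ : ℝ × EuclideanSpace ℝ (Fin d) → ℝ, IsTestFunction T φ →
    (∫ p, (y p * deriv (fun τ => φ (τ, p.2)) p.1
        - divSelf β (u p) * y p * psiLaplacian Ψ (fun x => φ (p.1, x)) p.2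
        + b (u p) * y p * fderiv ℝ (fun x => φ (p.1, x)) p.2 (D p.2)) ∂(spaceTimeMeasure d T))
      + ∫ᵛ x, φ (0, x) ∂•u₀ = 0

/-- The norm of `z` in `L^∞(0, T; L²(ℝ^d))` is finite. -/
def IsEssBoundedInL2 {d : ℕ} (T : ℝ) (z : ℝ × EuclideanSpace ℝ (Fin d) → ℝ) : Prop :=
  essSup (fun t => eLpNorm (fun x => z (t, x)) 2 volume) (volume.restrict (Ioo 0 T)) < ∞

/-- `lim_{t → 0} ess sup_{s ∈ (0,t)} |(z(s), ψ)_2| = 0` for all `ψ ∈ C_0^∞(ℝ^d)`. -/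
def VanishesWeaklyAtZero {d : ℕ} (z : ℝ × EuclideanSpace ℝ (Fin d) → ℝ) : Prop :=
  ∀ ψ : EuclideanSpace ℝ (Fin d) → ℝ, ContDiff ℝ (⊤ : ℕ∞) ψ → HasCompactSupport ψ →
    Tendsto (fun t : ℝ => essSup (fun s => ENNReal.ofReal |∫ x, z (s, x) * ψ x|)
      (volume.restrict (Ioo 0 t))) (𝓝[>] 0) (𝓝 0)

end

/-! Uniqueness follows from a weighted energy estimate on the Fourier side. Let z = y₁ - y₂, k =
β(u)/u, w = k z, v_j = b(u) D_j z. The measure u₀ cancels on subtraction, while test functions need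
not vanish at t = 0, so z solves z_t + Ψ(-Δ)w + div v = 0 with zero initial value built into the
weak form. As z is integrable, plane waves with a slowly varying cutoff can be used as spatial test
functions and the cutoff removed. Hence each mode satisfies ẑ(t,ξ) = ∫₀ᵗ (-Ψ ŵ + 2πi ξ·v̂) ds for
almost every t, where Ψ stands for Ψ(|2πξ|²) (`IsTensorSolution.spaceFourierInv_eq_primitive`).

The energy is E(t) = ∫ |ẑ|² q dξ with q = 1/(1+Ψ). Since Ψq = 1 - q, Plancherel turns the diffusion
into -2∫ z w dx plus a remainder carrying the factor q. With 0 ≤ k ≤ A one has w² ≤ A z w, so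
Young's inequality bounds the remainder by ∫ z w + A E. The other copy of ∫ z w pays for the drift:
by Young, its j-th part is at most δ|v̂_j|² + δ⁻¹(2πξ_j q)²|ẑ|², and s > 1/2 gives |2πξ|² q² ≤ η + K
q with η as small as desired (`exists_le_sq_add_of_rpow_le`). If β' > 0, then k ≥ α > 0 on the range
of u, and suitable δ and η let α∫z² absorb everything not controlled by E; if D = 0 there is nothing
to absorb and α = 0 is allowed. Thus E' ≤ const · E in integrated form, Grönwall gives E = 0, and q
> 0 gives z = 0 (`IsTensorSolution.ae_eq_zero`).

Two facts about Ψ(-Δ) support this. It maps test functions into L¹, so it can be paired with the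
merely bounded y₁ and y₂; this comes from Ψ(-Δ)ψ = ∫ (ψ - e^{tΔ}ψ) μ(dt) and the contractivity of
the heat semigroup. On modulated cutoffs it is bounded uniformly in the cutoff parameter and
converges pointwise to multiplication by the symbol. -/

/-! ### Plancherel's theorem for the integral transform on L¹ ∩ L². -/

section Plancherel

variable {V : Type*} [NormedAddCommGroup V] [InnerProductSpace ℝ V] [FiniteDimensional ℝ V]
  [MeasurableSpace V] [BorelSpace V]

theorem continuous_fourierInv_of_integrable {f : V → ℂ} (hf : Integrable f) :
    Continuous (𝓕⁻ f) := by
  have h : Continuous (𝓕 f) := VectorFourier.fourierIntegral_continuous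
    Real.continuous_fourierChar (innerSL ℝ).continuous₂ hf
  have : (𝓕⁻ f) = fun x => 𝓕 f (-x) := by
    ext x; exact Real.fourierInv_eq_fourier_neg f x
  rw [this]
  exact h.comp continuous_neg

theorem integral_fourier_mul_eq_flip {f g : V → ℂ} (hf : Integrable f) (hg : Integrable g) :
    ∫ ξ, 𝓕 f ξ * g ξ = ∫ x, f x * 𝓕 g x := by
  have := VectorFourier.integral_fourierIntegral_smul_eq_flip (μ := (volume : Measure V))
    (ν := (volume : Measure V)) (L := innerₗ V) Real.continuous_fourierChar continuous_inner hf hg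
  rwa [flip_innerₗ] at this

theorem integral_fourierInv_mul_eq_flip {f g : V → ℂ} (hf : Integrable f) (hg : Integrable g) :
    ∫ ξ, 𝓕⁻ f ξ * g ξ = ∫ x, f x * 𝓕⁻ g x := by
  rw [Real.fourierInv_eq_fourier_comp_neg f]
  rw [integral_fourier_mul_eq_flip hf.comp_neg hg, ← integral_neg_eq_self]
  simp [Real.fourierInv_eq_fourier_neg]

/-- Both transforms, the isometric extension to L² and the absolutely convergent integral, have the
same pairing with every test function: the first as a tempered distribution, the second by Fubini.
-/
theorem coeFn_Lp_fourierInv {f : V → ℂ} (hf : Integrable f) (hf2 : MemLp f 2) :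
    (𝓕⁻ (hf2.toLp f) : Lp ℂ 2 (volume : Measure V)) =ᵐ[volume] 𝓕⁻ f := by
  have hc := continuous_fourierInv_of_integrable hf
  refine ae_eq_of_integral_contDiff_smul_eq
    ((Lp.memLp _).locallyIntegrable one_le_two) hc.locallyIntegrable ?_
  intro g g_smooth g_cpt
  have hg₁ : HasCompactSupport (Complex.ofRealCLM ∘ g) := g_cpt.comp_left rfl
  have hg₂ : ContDiff ℝ (⊤ : ℕ∞) (Complex.ofRealCLM ∘ g) := by fun_prop
  set G : SchwartzMap V ℂ := hg₁.toSchwartzMap hg₂ with hG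
  have hGg : ∀ x, G x = (g x : ℂ) := fun x => by simp [hG]
  have h1 := congrArg (fun F => F G) (Lp.fourierInv_toTemperedDistribution_eq (hf2.toLp f))
  simp only [TemperedDistribution.fourierInv_apply, Lp.toTemperedDistribution_apply,
    smul_eq_mul, hGg] at h1
  calc ∫ x, g x • (𝓕⁻ (hf2.toLp f) : Lp ℂ 2 (volume : Measure V)) x
      = ∫ x, (g x : ℂ) * (𝓕⁻ (hf2.toLp f) : Lp ℂ 2 (volume : Measure V)) x := by
        simp only [Complex.real_smul]
    _ = ∫ x, (𝓕⁻ G) x * (hf2.toLp f) x := h1.symm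
    _ = ∫ x, f x * 𝓕⁻ (G : V → ℂ) x := by
        refine integral_congr_ae ?_
        filter_upwards [hf2.coeFn_toLp] with x hx
        rw [hx, mul_comm, SchwartzMap.fourierInv_coe]
    _ = ∫ x, 𝓕⁻ f x * G x := (integral_fourierInv_mul_eq_flip hf G.integrable).symm
    _ = _ := by
        refine integral_congr_ae (ae_of_all _ fun x => ?_)
        simp only [hGg, Complex.real_smul, mul_comm]

theorem memLp_two_fourierInv {f : V → ℂ} (hf : Integrable f) (hf2 : MemLp f 2) :
    MemLp (𝓕⁻ f) 2 :=
  (memLp_congr_ae (coeFn_Lp_fourierInv hf hf2)).1 (Lp.memLp _)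

theorem integral_conj_fourierInv_mul_fourierInv {f g : V → ℂ} (hf : Integrable f)
    (hf2 : MemLp f 2) (hg : Integrable g) (hg2 : MemLp g 2) :
    ∫ ξ, starRingEnd ℂ (𝓕⁻ f ξ) * 𝓕⁻ g ξ = ∫ x, starRingEnd ℂ (f x) * g x := by
  have h := (Lp.fourierTransformₗᵢ V ℂ).symm.inner_map_map (hf2.toLp f) (hg2.toLp g)
  rw [L2.inner_def, L2.inner_def] at h
  refine Eq.trans (integral_congr_ae ?_) (h.trans (integral_congr_ae ?_))
  · filter_upwards [coeFn_Lp_fourierInv hf hf2, coeFn_Lp_fourierInv hg hg2] with x hx hy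
    change _ = inner ℂ ((𝓕⁻ (hf2.toLp f) : Lp ℂ 2 (volume : Measure V)) x)
      ((𝓕⁻ (hg2.toLp g) : Lp ℂ 2 (volume : Measure V)) x)
    rw [hx, hy, RCLike.inner_apply, mul_comm]
  · filter_upwards [hf2.coeFn_toLp, hg2.coeFn_toLp] with x hx hy
    rw [hx, hy, RCLike.inner_apply, mul_comm]

theorem integral_norm_sq_fourierInv {f : V → ℂ} (hf : Integrable f) (hf2 : MemLp f 2) :
    ∫ ξ, ‖𝓕⁻ f ξ‖ ^ 2 = ∫ x, ‖f x‖ ^ 2 := by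
  have h := integral_conj_fourierInv_mul_fourierInv hf hf2 hf hf2
  simp only [Complex.conj_mul', ← Complex.ofReal_pow] at h
  rw [integral_complex_ofReal, integral_complex_ofReal] at h
  exact_mod_cast h

end Plancherel

/-! ### L¹ contractivity of the heat semigroup. -/

section HeatKernel

variable {V : Type*} [NormedAddCommGroup V] [InnerProductSpace ℝ V] [FiniteDimensional ℝ V]
  [MeasurableSpace V] [BorelSpace V]

theorem integrable_rexp_neg_mul_sq_norm {b : ℝ} (hb : 0 < b) :
    Integrable (fun v : V => Real.exp (-b * ‖v‖ ^ 2)) := by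
  have h := (GaussianFourier.integrable_cexp_neg_mul_sq_norm_add (V := V) (b := (b : ℂ))
    (by simpa using hb) 0 0).norm
  refine h.congr (ae_of_all _ fun v => ?_)
  simp [Complex.norm_exp, ← Complex.ofReal_pow]

theorem integral_rexp_gaussian_normalized {b : ℝ} (hb : 0 < b) :
    (Real.pi / b) ^ (Module.finrank ℝ V / 2 : ℝ) *
      ∫ v : V, Real.exp (-(Real.pi ^ 2 / b) * ‖v‖ ^ 2) = 1 := by
  have hπ := Real.pi_pos
  rw [GaussianFourier.integral_rexp_neg_mul_sq_norm (by positivity),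
    ← Real.mul_rpow (by positivity) (by positivity)]
  have : Real.pi / b * (Real.pi / (Real.pi ^ 2 / b)) = 1 := by field_simp
  rw [this, Real.one_rpow]

/-- Moving the transform from f onto the modulated Gaussian avoids Fourier inversion, so f ∈ L¹
suffices. -/
theorem fourierInv_gaussian_mul_fourier {b : ℝ} (hb : 0 < b) {f : V → ℂ} (hf : Integrable f)
    (x : V) :
    𝓕⁻ (fun ξ => (Real.exp (-b * ‖ξ‖ ^ 2) : ℂ) * 𝓕 f ξ) x =
      ∫ y, f y * (((Real.pi / b) ^ (Module.finrank ℝ V / 2 : ℝ) *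
        Real.exp (-(Real.pi ^ 2 / b) * ‖x - y‖ ^ 2) : ℝ) : ℂ) := by
  set g : V → ℂ := fun ξ => Complex.exp (-(b : ℂ) * ‖ξ‖ ^ 2 + 2 * Real.pi * Complex.I * inner ℝ x ξ)
    with hg
  have hgi : Integrable g :=
    GaussianFourier.integrable_cexp_neg_mul_sq_norm_add (by simpa using hb) _ _
  calc _ = ∫ ξ, 𝓕 f ξ * g ξ := by
        rw [Real.fourierInv_eq']
        refine integral_congr_ae (ae_of_all _ fun ξ => ?_)
        simp only [hg, smul_eq_mul, Complex.exp_add, Complex.ofReal_exp]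
        rw [real_inner_comm]
        push_cast
        have : 2 * (Real.pi : ℂ) * ↑(inner ℝ x ξ) * Complex.I =
          2 * ↑Real.pi * Complex.I * ↑(inner ℝ x ξ) := by ring
        rw [this]
        ring
    _ = ∫ y, f y * 𝓕 g y := integral_fourier_mul_eq_flip hf hgi
    _ = _ := by
        refine integral_congr_ae (ae_of_all _ fun y => ?_)
        simp only [hg]
        rw [fourier_gaussian_innerProductSpace' (by simpa using hb)]
        congr 1
        push_cast
        rw [Complex.ofReal_cpow (by positivity)]
        push_cast
        congr 2
        ring

/-- The operator is convolution with a nonnegative kernel of mass one, hence an L¹ contraction. -/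
theorem integrable_fourierInv_gaussian_mul_fourier {b : ℝ} (hb : 0 < b) {f : V → ℂ}
    (hf : Integrable f) :
    Integrable (𝓕⁻ (fun ξ => (Real.exp (-b * ‖ξ‖ ^ 2) : ℂ) * 𝓕 f ξ)) ∧
      ∫ x, ‖𝓕⁻ (fun ξ => (Real.exp (-b * ‖ξ‖ ^ 2) : ℂ) * 𝓕 f ξ) x‖ ≤ ∫ x, ‖f x‖ := by
  set k : V → ℝ := fun w => (Real.pi / b) ^ (Module.finrank ℝ V / 2 : ℝ) *
    Real.exp (-(Real.pi ^ 2 / b) * ‖w‖ ^ 2) with hk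
  have hki : Integrable (fun w => (k w : ℂ)) :=
    ((integrable_rexp_neg_mul_sq_norm (by positivity)).const_mul _).ofReal
  have hk0 : ∀ w, 0 ≤ k w := fun w => by positivity
  have hk1 : ∫ w, ‖(k w : ℂ)‖ = 1 := by
    simp_rw [Complex.norm_real, Real.norm_of_nonneg (hk0 _), hk, integral_const_mul]
    exact integral_rexp_gaussian_normalized hb
  have heq : 𝓕⁻ (fun ξ => (Real.exp (-b * ‖ξ‖ ^ 2) : ℂ) * 𝓕 f ξ) =
      fun x => ∫ y, f y * (k (x - y) : ℂ) :=
    funext fun x => fourierInv_gaussian_mul_fourier hb hf x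
  have hint : Integrable (fun p : V × V => f p.2 * (k (p.1 - p.2) : ℂ))
      ((volume : Measure V).prod volume) :=
    hf.convolution_integrand (ContinuousLinearMap.mul ℂ ℂ) hki
  rw [heq]
  refine ⟨hint.integral_prod_left, ?_⟩
  calc ∫ x, ‖∫ y, f y * (k (x - y) : ℂ)‖ ≤ ∫ x, ∫ y, ‖f y * (k (x - y) : ℂ)‖ :=
        integral_mono hint.integral_prod_left.norm hint.norm.integral_prod_left
          fun x => norm_integral_le_integral_norm _
    _ = ∫ y, ∫ x, ‖f y * (k (x - y) : ℂ)‖ := integral_integral_swap hint.norm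
    _ = ∫ y, ‖f y‖ := by
        refine integral_congr_ae (ae_of_all _ fun y => ?_)
        simp only [norm_mul, integral_const_mul]
        rw [integral_sub_right_eq_self (fun x => ‖(k x : ℂ)‖) y, hk1, mul_one]

end HeatKernel

/-! ### Averaging multipliers over a parameter. -/

section Superposition

variable {V : Type*} [NormedAddCommGroup V] [InnerProductSpace ℝ V] [FiniteDimensional ℝ V]
  [MeasurableSpace V] [BorelSpace V]

/-- Minkowski's inequality in `L¹` for inverse Fourier transforms depending on a parameter. -/
theorem integrable_fourierInv_integral {ν : Measure ℝ} [SFinite ν] {M : ℝ × V → ℂ}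
    (hM : Measurable M) {a c : ℝ → ℝ} {B : V → ℝ} (ha : Integrable a ν) (hB : Integrable B)
    (hab : ∀ᵐ t ∂ν, ∀ ξ, ‖M (t, ξ)‖ ≤ a t * B ξ) (hc : Integrable c ν)
    (hMc : ∀ᵐ t ∂ν, Integrable (𝓕⁻ (fun ξ => M (t, ξ))) ∧
      ∫ x, ‖𝓕⁻ (fun ξ => M (t, ξ)) x‖ ≤ c t) :
    Integrable (𝓕⁻ (fun ξ => ∫ t, M (t, ξ) ∂ν)) ∧
      ∫ x, ‖𝓕⁻ (fun ξ => ∫ t, M (t, ξ) ∂ν) x‖ ≤ ∫ t, c t ∂ν := by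
  have hMi : Integrable M (ν.prod volume) := by
    refine (ha.mul_prod hB).mono' hM.aestronglyMeasurable ?_
    have : ∀ᵐ p ∂ν.prod (volume : Measure V), ∀ ξ, ‖M (p.1, ξ)‖ ≤ a p.1 * B ξ :=
      Measure.quasiMeasurePreserving_fst.ae hab
    filter_upwards [this] with p hp using hp p.2
  set Φ : ℝ × V → ℂ := fun p => 𝓕⁻ (fun ξ => M (p.1, ξ)) p.2 with hΦ
  have hΦm : StronglyMeasurable Φ := by
    have : Φ = fun p : ℝ × V => ∫ ξ, Real.fourierChar (inner ℝ ξ p.2) • M (p.1, ξ) := by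
      ext p; exact Real.fourierInv_eq _ _
    rw [this]
    have h1 : StronglyMeasurable (fun q : (ℝ × V) × V =>
        Real.fourierChar (inner ℝ q.2 q.1.2) • M (q.1.1, q.2)) := by
      refine Measurable.stronglyMeasurable ?_
      simp only [Circle.smul_def, smul_eq_mul]
      refine Measurable.mul ?_ (by fun_prop)
      have : Continuous fun q : (ℝ × V) × V => (Real.fourierChar (inner ℝ q.2 q.1.2) : ℂ) :=
        continuous_subtype_val.comp (Real.continuous_fourierChar.comp (by fun_prop))
      exact this.measurable
    exact h1.integral_prod_right'
  have hΦi : Integrable Φ (ν.prod volume) := by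
    rw [integrable_prod_iff hΦm.aestronglyMeasurable]
    refine ⟨hMc.mono fun t ht => ht.1, hc.mono' ?_ ?_⟩
    · exact hΦm.norm.integral_prod_right'.aestronglyMeasurable
    · filter_upwards [hMc] with t ht
      rw [Real.norm_of_nonneg (integral_nonneg fun _ => norm_nonneg _)]
      exact ht.2
  have heq : 𝓕⁻ (fun ξ => ∫ t, M (t, ξ) ∂ν) = fun x : V => ∫ t, Φ (t, x) ∂ν := by
    ext x
    simp only [hΦ, Real.fourierInv_eq]
    have hint : Integrable (fun p : ℝ × V => Real.fourierChar (inner ℝ p.2 x) • M p)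
        (ν.prod volume) := by
      refine hMi.norm.mono' ?_ (ae_of_all _ fun p => by rw [Circle.norm_smul])
      have h2 : Continuous fun p : ℝ × V => (Real.fourierChar (inner ℝ p.2 x) : ℂ) :=
        continuous_subtype_val.comp (Real.continuous_fourierChar.comp (by fun_prop))
      simp only [Circle.smul_def, smul_eq_mul]
      exact (h2.measurable.mul hM).aestronglyMeasurable
    rw [integral_integral_swap (f := fun t ξ => Real.fourierChar (inner ℝ ξ x) • M (t, ξ)) hint]
    refine integral_congr_ae (ae_of_all _ fun ξ => ?_)
    simp only [Circle.smul_def, integral_smul]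
  rw [heq]
  refine ⟨hΦi.integral_prod_right, ?_⟩
  calc ∫ x : V, ‖∫ t, Φ (t, x) ∂ν‖ ≤ ∫ x : V, ∫ t, ‖Φ (t, x)‖ ∂ν :=
        integral_mono hΦi.integral_prod_right.norm hΦi.norm.integral_prod_right
          fun x => norm_integral_le_integral_norm _
    _ = ∫ t, (∫ x, ‖Φ (t, x)‖) ∂ν := (integral_integral_swap hΦi.norm).symm
    _ ≤ ∫ t, c t ∂ν := integral_mono_ae hΦi.norm.integral_prod_left hc
        (hMc.mono fun t ht => ht.2)

end Superposition

/-! ### The Lévy measure and the growth of Ψ. -/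

namespace HasLevyKhintchineRepr

variable {Ψ : ℝ → ℝ} {μ : Measure ℝ}

/-- The measure may have infinite mass near 0, but with density min(1,t) it becomes finite, and this
density is positive on (0,∞) and can be divided out again. S-finiteness is what Fubini over μ needs.
-/
theorem sFinite_restrict {a₁ a₂ : ℝ} (h : HasLevyKhintchineRepr Ψ a₁ a₂ μ) :
    SFinite (μ.restrict (Ioi 0)) := by
  have hm : Measurable fun t : ℝ => ENNReal.ofReal (min 1 t) := by fun_prop
  have hfin : IsFiniteMeasure
      ((μ.restrict (Ioi 0)).withDensity fun t : ℝ => ENNReal.ofReal (min 1 t)) :=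
    isFiniteMeasure_withDensity h.finite.ne
  rw [← withDensity_inv_same (μ := μ.restrict (Ioi 0)) hm]
  · infer_instance
  · filter_upwards [ae_restrict_mem measurableSet_Ioi] with t ht
    simpa using ht
  · exact ae_of_all _ fun _ => ENNReal.ofReal_ne_top

theorem integrable_min {a₁ a₂ : ℝ} (h : HasLevyKhintchineRepr Ψ a₁ a₂ μ) :
    Integrable (fun t : ℝ => min 1 t) (μ.restrict (Ioi 0)) := by
  refine ⟨by fun_prop, ?_⟩
  rw [hasFiniteIntegral_iff_norm]
  refine lt_of_eq_of_lt ?_ h.finite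
  refine setLIntegral_congr_fun measurableSet_Ioi fun t ht => ?_
  rw [Real.norm_of_nonneg (le_min zero_le_one (le_of_lt ht))]

end HasLevyKhintchineRepr

theorem norm_one_sub_exp_neg_mul_le {r t : ℝ} (hr : 0 ≤ r) (ht : 0 < t) :
    ‖1 - Real.exp (-(r * t))‖ ≤ min 1 t * (1 + r) := by
  have h0 : 0 ≤ r * t := by positivity
  have h1 : Real.exp (-(r * t)) ≤ 1 := Real.exp_le_one_iff.2 (by linarith)
  have h2 : 1 - r * t ≤ Real.exp (-(r * t)) := by
    have := Real.add_one_le_exp (-(r * t)); linarith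
  have h3 := Real.exp_pos (-(r * t))
  rw [Real.norm_of_nonneg (by linarith)]
  rcases le_total 1 t with h | h
  · rw [min_eq_left h]; linarith
  · rw [min_eq_right h]; nlinarith

namespace HasLevyKhintchineRepr

variable {Ψ : ℝ → ℝ} {μ : Measure ℝ}

theorem le_mul_one_add (h : HasLevyKhintchineRepr Ψ 0 0 μ) {r : ℝ} (hr : 0 ≤ r) :
    Ψ r ≤ (∫ t in Ioi 0, min 1 t ∂μ) * (1 + r) := by
  rw [h.eq r hr, ← integral_mul_const]
  simp only [zero_mul, zero_add]
  have hi := h.integrable_min.mul_const (1 + r)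
  refine (le_abs_self _).trans (norm_integral_le_of_norm_le (f := fun t => 1 - Real.exp (-(r * t))) hi ?_)
  filter_upwards [ae_restrict_mem measurableSet_Ioi] with t ht
  exact norm_one_sub_exp_neg_mul_le hr ht

end HasLevyKhintchineRepr

/-! ### Ψ(-Δ) maps Schwartz functions into L¹. -/

section Multiplier

variable {V : Type*} [NormedAddCommGroup V] [InnerProductSpace ℝ V] [FiniteDimensional ℝ V]
  [MeasurableSpace V] [BorelSpace V]

theorem integrable_fourierInv_heat_mul_fourier {t : ℝ} (ht : 0 < t) {f : V → ℂ}
    (hf : Integrable f) :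
    Integrable (𝓕⁻ (fun ξ => (Real.exp (-((2 * Real.pi * ‖ξ‖) ^ 2 * t)) : ℂ) * 𝓕 f ξ)) ∧
      ∫ x, ‖𝓕⁻ (fun ξ => (Real.exp (-((2 * Real.pi * ‖ξ‖) ^ 2 * t)) : ℂ) * 𝓕 f ξ) x‖
        ≤ ∫ x, ‖f x‖ := by
  have hb : 0 < (2 * Real.pi) ^ 2 * t := by positivity
  have h := integrable_fourierInv_gaussian_mul_fourier hb hf
  have e : ∀ ξ : V, -((2 * Real.pi) ^ 2 * t) * ‖ξ‖ ^ 2 = -((2 * Real.pi * ‖ξ‖) ^ 2 * t) :=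
    fun ξ => by ring
  simpa only [e] using h

theorem fourierInv_sub_of_integrable {f g : V → ℂ} (hf : Integrable f) (hg : Integrable g) :
    𝓕⁻ (fun ξ => f ξ - g ξ) = fun x => 𝓕⁻ f x - 𝓕⁻ g x := by
  ext x
  simp only [Real.fourierInv_eq, smul_sub]
  have key : ∀ {f : V → ℂ}, Integrable f →
      Integrable fun v => Real.fourierChar (inner ℝ v x) • f v := fun {f} hf => by
    have := (Real.fourierIntegral_convergent_iff (μ := (volume : Measure V)) (-x)).2 hf
    simpa using this
  exact integral_sub (key hf) (key hg)

/-- The function g is -Δf, constructed on the Fourier side. -/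
theorem exists_schwartz_fourier_eq_norm_sq_mul (f : SchwartzMap V ℂ) :
    ∃ g : SchwartzMap V ℂ, ∀ ξ,
      𝓕 (g : V → ℂ) ξ = (((2 * Real.pi * ‖ξ‖) ^ 2 : ℝ) : ℂ) * 𝓕 (f : V → ℂ) ξ := by
  have hr : (fun ξ : V => ((2 * Real.pi * ‖ξ‖) ^ 2 : ℝ)).HasTemperateGrowth := by
    simp only [mul_pow]
    exact (Function.HasTemperateGrowth.const _).mul (Function.hasTemperateGrowth_norm_sq V)
  have hr' : (fun ξ : V => (((2 * Real.pi * ‖ξ‖) ^ 2 : ℝ) : ℂ)).HasTemperateGrowth :=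
    Function.HasTemperateGrowth.comp Function.Complex.hasTemperateGrowth_ofReal hr
  refine ⟨𝓕⁻ (SchwartzMap.smulLeftCLM ℂ (fun ξ : V => (((2 * Real.pi * ‖ξ‖) ^ 2 : ℝ) : ℂ)) (𝓕 f)),
    fun ξ => ?_⟩
  rw [← SchwartzMap.fourier_coe, FourierTransform.fourier_fourierInv_eq,
    SchwartzMap.smulLeftCLM_apply_apply hr', SchwartzMap.fourier_coe, smul_eq_mul]

/-- The function is f - e^{tΔ}f. Contractivity bounds its L¹ norm by 2‖f‖₁; writing it as ∫₀ᵗ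
e^{sΔ}(-Δf) ds bounds the norm by t‖Δf‖₁. The minimum of the two matches the integrability condition
on the Lévy measure. -/
theorem exists_integral_norm_fourierInv_one_sub_heat_le (f : SchwartzMap V ℂ) :
    ∃ A : ℝ, 0 ≤ A ∧ ∀ t : ℝ, 0 < t →
      Integrable (𝓕⁻ (fun ξ => ((1 - Real.exp (-((2 * Real.pi * ‖ξ‖) ^ 2 * t)) : ℝ) : ℂ) *
        𝓕 (f : V → ℂ) ξ)) ∧
      ∫ x, ‖𝓕⁻ (fun ξ => ((1 - Real.exp (-((2 * Real.pi * ‖ξ‖) ^ 2 * t)) : ℝ) : ℂ) *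
        𝓕 (f : V → ℂ) ξ) x‖ ≤ A * min 1 t := by
  obtain ⟨g, hg⟩ := exists_schwartz_fourier_eq_norm_sq_mul f
  have hf0 : 0 ≤ ∫ x, ‖f x‖ := integral_nonneg fun _ => norm_nonneg _
  have hg0 : 0 ≤ ∫ x, ‖g x‖ := integral_nonneg fun _ => norm_nonneg _
  refine ⟨2 * (∫ x, ‖f x‖) + ∫ x, ‖g x‖, by positivity, fun t ht => ?_⟩
  have hFi : Integrable (𝓕 (f : V → ℂ)) := (𝓕 f).integrable
  have hGi : Integrable (𝓕 (g : V → ℂ)) := (𝓕 g).integrable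
  obtain ⟨hi, hle⟩ := integrable_fourierInv_heat_mul_fourier ht f.integrable
  have hexp : Continuous fun ξ : V => (Real.exp (-((2 * Real.pi * ‖ξ‖) ^ 2 * t)) : ℂ) :=
    Complex.continuous_ofReal.comp (by fun_prop)
  have hheat : Integrable
      (fun ξ => (Real.exp (-((2 * Real.pi * ‖ξ‖) ^ 2 * t)) : ℂ) * 𝓕 (f : V → ℂ) ξ) := by
    refine hFi.bdd_mul (c := 1) hexp.aestronglyMeasurable (ae_of_all _ fun ξ => ?_)
    rw [Complex.norm_real, Real.norm_of_nonneg (Real.exp_pos _).le]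
    exact Real.exp_le_one_iff.2 (by simp; positivity)
  have heq : 𝓕⁻ (fun ξ => ((1 - Real.exp (-((2 * Real.pi * ‖ξ‖) ^ 2 * t)) : ℝ) : ℂ) *
      𝓕 (f : V → ℂ) ξ) = fun x => f x -
        𝓕⁻ (fun ξ => (Real.exp (-((2 * Real.pi * ‖ξ‖) ^ 2 * t)) : ℂ) * 𝓕 (f : V → ℂ) ξ) x := by
    have h1 := fourierInv_sub_of_integrable hFi hheat
    have h2 : 𝓕⁻ (𝓕 (f : V → ℂ)) = f := by
      rw [← SchwartzMap.fourier_coe, ← SchwartzMap.fourierInv_coe,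
        FourierTransform.fourierInv_fourier_eq]
    rw [h2] at h1
    rw [← h1]
    congr 1
    ext ξ
    push_cast
    ring
  refine ⟨heq ▸ f.integrable.sub hi, ?_⟩
  rw [mul_min_of_nonneg _ _ (by positivity), mul_one]
  refine le_min ?_ ?_
  · rw [heq]
    calc _ ≤ ∫ x, (‖f x‖ + ‖𝓕⁻ (fun ξ => (Real.exp (-((2 * Real.pi * ‖ξ‖) ^ 2 * t)) : ℂ) *
          𝓕 (f : V → ℂ) ξ) x‖) :=
          integral_mono (f.integrable.sub hi).norm (f.integrable.norm.add hi.norm)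
            fun x => norm_sub_le _ _
      _ ≤ _ := by
          rw [integral_add f.integrable.norm hi.norm]
          linarith
  · have hsup := integrable_fourierInv_integral (ν := volume.restrict (Ioc 0 t))
      (M := fun p : ℝ × V => (Real.exp (-((2 * Real.pi * ‖p.2‖) ^ 2 * p.1)) : ℂ) *
        𝓕 (g : V → ℂ) p.2) (a := fun _ => 1) (c := fun _ => ∫ x, ‖g x‖)
      (B := fun ξ => ‖𝓕 (g : V → ℂ) ξ‖) ?_ (integrable_const _) hGi.norm ?_
      (integrable_const _) ?_
    · have hint : (fun ξ => ∫ s in Ioc 0 t, (Real.exp (-((2 * Real.pi * ‖ξ‖) ^ 2 * s)) : ℂ) *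
          𝓕 (g : V → ℂ) ξ) = (fun ξ => ((1 - Real.exp (-((2 * Real.pi * ‖ξ‖) ^ 2 * t)) : ℝ) : ℂ) *
            𝓕 (f : V → ℂ) ξ) := by
        ext ξ
        rw [integral_mul_const, hg, ← mul_assoc]
        congr 1
        rw [integral_complex_ofReal, ← Complex.ofReal_mul, ← integral_mul_const,
          ← intervalIntegral.integral_of_le ht.le]
        congr 1
        set r := (2 * Real.pi * ‖ξ‖) ^ 2
        have hd : ∀ s ∈ uIcc 0 t, HasDerivAt (fun s => -Real.exp (-(r * s)))
            (Real.exp (-(r * s)) * r) s := fun s _ => by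
          simpa using (((hasDerivAt_id s).const_mul r).fun_neg.exp).fun_neg
        rw [intervalIntegral.integral_eq_sub_of_hasDerivAt hd
          (Continuous.intervalIntegrable (by fun_prop) _ _)]
        simp
        ring
      simp only at hsup
      rw [hint] at hsup
      refine hsup.2.trans ?_
      simp [ht.le]
      nlinarith
    · refine Measurable.mul ?_ ?_
      · exact (Complex.continuous_ofReal.comp (by fun_prop)).measurable
      · exact ((𝓕 g).continuous.comp continuous_snd).measurable
    · filter_upwards [ae_restrict_mem measurableSet_Ioc] with s hs ξ
      rw [norm_mul, Complex.norm_real, Real.norm_of_nonneg (Real.exp_pos _).le]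
      refine mul_le_mul_of_nonneg_right ?_ (norm_nonneg _)
      have := hs.1
      exact Real.exp_le_one_iff.2 (by simp; positivity)
    · filter_upwards [ae_restrict_mem measurableSet_Ioc] with s hs
      exact integrable_fourierInv_heat_mul_fourier hs.1 g.integrable

theorem integrable_one_add_norm_sq_mul_fourier (f : SchwartzMap V ℂ) :
    Integrable fun ξ => (1 + (2 * Real.pi * ‖ξ‖) ^ 2) * ‖𝓕 (f : V → ℂ) ξ‖ := by
  obtain ⟨g, hg⟩ := exists_schwartz_fourier_eq_norm_sq_mul f
  have hFi : Integrable (𝓕 (f : V → ℂ)) := (𝓕 f).integrable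
  have hGi : Integrable (𝓕 (g : V → ℂ)) := (𝓕 g).integrable
  refine (hFi.norm.add hGi.norm).congr (ae_of_all _ fun ξ => ?_)
  simp only [Pi.add_apply, hg, norm_mul, Complex.norm_real]
  rw [Real.norm_of_nonneg (by positivity)]
  ring

/-- Subordination: integrating f - e^{tΔ}f against μ, whose L¹ norm is O(min(1,t)), produces Ψ(-Δ)f.
-/
theorem HasLevyKhintchineRepr.integrable_fourierInv_mul_fourier {Ψ : ℝ → ℝ} {μ : Measure ℝ}
    (h : HasLevyKhintchineRepr Ψ 0 0 μ) (f : SchwartzMap V ℂ) :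
    Integrable (𝓕⁻ (fun ξ => (Ψ ((2 * Real.pi * ‖ξ‖) ^ 2) : ℂ) * 𝓕 (f : V → ℂ) ξ)) := by
  have := h.sFinite_restrict
  obtain ⟨A, hA, hAt⟩ := exists_integral_norm_fourierInv_one_sub_heat_le f
  have hsup := integrable_fourierInv_integral (ν := μ.restrict (Ioi 0))
      (M := fun p : ℝ × V => ((1 - Real.exp (-((2 * Real.pi * ‖p.2‖) ^ 2 * p.1)) : ℝ) : ℂ) *
        𝓕 (f : V → ℂ) p.2) (a := fun t => min 1 t) (c := fun t => A * min 1 t)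
      (B := fun ξ => (1 + (2 * Real.pi * ‖ξ‖) ^ 2) * ‖𝓕 (f : V → ℂ) ξ‖) ?_ h.integrable_min
      (integrable_one_add_norm_sq_mul_fourier f) ?_ (h.integrable_min.const_mul _) ?_
  · convert hsup.1 using 2
    ext ξ
    simp only
    rw [integral_mul_const, integral_complex_ofReal, h.eq _ (by positivity)]
    simp
  · refine Measurable.mul ?_ ?_
    · exact (Complex.continuous_ofReal.comp (by fun_prop)).measurable
    · exact ((𝓕 f).continuous.comp continuous_snd).measurable
  · filter_upwards [ae_restrict_mem measurableSet_Ioi] with t ht ξ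
    rw [norm_mul, Complex.norm_real, ← mul_assoc]
    exact mul_le_mul_of_nonneg_right (norm_one_sub_exp_neg_mul_le (by positivity) ht)
      (norm_nonneg _)
  · filter_upwards [ae_restrict_mem measurableSet_Ioi] with t ht
    exact hAt t ht

end Multiplier

/-! ### Plane waves. -/

section PlaneWave

variable {V : Type*} [NormedAddCommGroup V] [InnerProductSpace ℝ V]

/-- The plane wave `x ↦ e^{2πi⟨x, ξ⟩}`. -/
noncomputable def planeWave (ξ x : V) : ℂ := (Real.fourierChar (inner ℝ x ξ) : ℂ)

theorem planeWave_eq_exp (ξ x : V) :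
    planeWave ξ x = Complex.exp (((2 * Real.pi * inner ℝ x ξ : ℝ) : ℂ) * Complex.I) := by
  rw [planeWave, Real.fourierChar_apply]

theorem norm_planeWave (ξ x : V) : ‖planeWave ξ x‖ = 1 := Circle.norm_coe _

theorem continuous_planeWave : Continuous fun p : V × V => planeWave p.1 p.2 :=
  continuous_subtype_val.comp (Real.continuous_fourierChar.comp (by fun_prop))

/-- Separating the fixed frequency ξ from η gives a majorant independent of ε for symbols of
quadratic growth. -/
theorem norm_add_sq_le_of_le_one {ε : ℝ} (hε : 0 < ε) (hε1 : ε ≤ 1) (ξ η : V) :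
    1 + (2 * Real.pi * ‖ξ + ε • η‖) ^ 2 ≤
      (1 + 2 * (2 * Real.pi * ‖ξ‖) ^ 2 + 2) * (1 + (2 * Real.pi * ‖η‖) ^ 2) := by
  have h1 : ‖ξ + ε • η‖ ≤ ‖ξ‖ + ‖η‖ := by
    refine (norm_add_le _ _).trans ?_
    rw [norm_smul, Real.norm_of_nonneg hε.le]
    nlinarith [norm_nonneg η]
  have h2 : 2 * Real.pi * ‖ξ + ε • η‖ ≤ 2 * Real.pi * ‖ξ‖ + 2 * Real.pi * ‖η‖ := by
    have := Real.pi_pos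
    nlinarith
  have h0 : 0 ≤ 2 * Real.pi * ‖ξ + ε • η‖ := by positivity
  set a := 2 * Real.pi * ‖ξ‖
  set c := 2 * Real.pi * ‖η‖
  nlinarith [sq_nonneg (a - c), pow_le_pow_left₀ h0 h2 2, sq_nonneg (a * c), sq_nonneg a,
    sq_nonneg c]

end PlaneWave

/-! ### Multipliers acting on plane waves with a dilated amplitude. -/

section ModulatedDilation

variable {V : Type*} [NormedAddCommGroup V] [InnerProductSpace ℝ V] [FiniteDimensional ℝ V]
  [MeasurableSpace V] [BorelSpace V]

theorem integrable_fourierChar_smul {f : V → ℂ} (hf : Integrable f) (x : V) :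
    Integrable fun v => Real.fourierChar (inner ℝ v x) • f v := by
  have := (Real.fourierIntegral_convergent_iff (μ := (volume : Measure V)) (-x)).2 hf
  simpa using this

theorem fourierInv_linear_combination {f g : V → ℂ} (hf : Integrable f) (hg : Integrable g)
    (a b : ℂ) (x : V) :
    𝓕⁻ (fun ξ => a * f ξ + b * g ξ) x = a * 𝓕⁻ f x + b * 𝓕⁻ g x := by
  simp only [Real.fourierInv_eq]
  rw [← integral_const_mul, ← integral_const_mul, ← integral_add
    ((integrable_fourierChar_smul hf x).const_mul a)
    ((integrable_fourierChar_smul hg x).const_mul b)]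
  refine integral_congr_ae (ae_of_all _ fun v => ?_)
  simp only [Circle.smul_def, smul_eq_mul]
  ring

theorem fourier_linear_combination {f g : V → ℂ} (hf : Integrable f) (hg : Integrable g)
    (a b : ℂ) (x : V) :
    𝓕 (fun ξ => a * f ξ + b * g ξ) x = a * 𝓕 f x + b * 𝓕 g x := by
  have := fourierInv_linear_combination hf hg a b (-x)
  simpa [Real.fourierInv_eq_fourier_neg] using this

theorem fourierInv_eq_integral_planeWave (f : V → ℂ) (ξ : V) :
    𝓕⁻ f ξ = ∫ x, planeWave ξ x * f x := by
  rw [Real.fourierInv_eq]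
  simp only [Circle.smul_def, smul_eq_mul, planeWave]

theorem fourier_dilation_mul_planeWave (k : V → ℂ) {ε : ℝ} (hε : 0 < ε) (ξ₀ ξ : V) :
    𝓕 (fun x => k (ε • x) * planeWave ξ₀ x) ξ =
      ((ε ^ Module.finrank ℝ V)⁻¹ : ℝ) * 𝓕 k (ε⁻¹ • (ξ - ξ₀)) := by
  rw [Real.fourier_eq, Real.fourier_eq]
  have h := Measure.integral_comp_smul (volume : Measure V)
    (fun y => Real.fourierChar (-inner ℝ y (ε⁻¹ • (ξ - ξ₀))) • k y) ε
  rw [abs_of_pos (by positivity), Complex.real_smul] at h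
  rw [← h]
  refine integral_congr_ae (ae_of_all _ fun x => ?_)
  simp only [planeWave, Circle.smul_def, smul_eq_mul, inner_smul_left, inner_smul_right,
    inner_sub_right, Real.fourierChar_apply]
  rw [mul_comm (k _), ← mul_assoc, ← Complex.exp_add]
  congr 2
  have : (starRingEnd ℝ) ε = ε := rfl
  rw [this, ← mul_sub, inv_mul_cancel_left₀ hε.ne']
  push_cast
  ring

/-- The spectrum of the modulated amplitude concentrates at ξ₀ on scale ε. The substitution ξ = ξ₀ +
εη cancels the Jacobian and leaves ε only inside continuous factors. -/
theorem fourierInv_mul_fourier_dilation_mul_planeWave (m : V → ℂ) (k : V → ℂ) {ε : ℝ}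
    (hε : 0 < ε) (ξ₀ x : V) :
    𝓕⁻ (fun ξ => m ξ * 𝓕 (fun x => k (ε • x) * planeWave ξ₀ x) ξ) x =
      ∫ η, planeWave x (ξ₀ + ε • η) * (m (ξ₀ + ε • η) * 𝓕 k η) := by
  set H : V → ℂ := fun η => planeWave x (ξ₀ + ε • η) * (m (ξ₀ + ε • η) * 𝓕 k η) with hH
  have h1 := Measure.integral_comp_inv_smul (volume : Measure V) H ε
  have h2 := integral_sub_right_eq_self (μ := (volume : Measure V)) (fun ξ => H (ε⁻¹ • ξ)) ξ₀
  have hε' : ε ^ Module.finrank ℝ V ≠ 0 := by positivity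
  rw [abs_of_pos (by positivity), Complex.real_smul] at h1
  calc _ = ∫ ξ, ((ε ^ Module.finrank ℝ V)⁻¹ : ℝ) * H (ε⁻¹ • (ξ - ξ₀)) := by
        rw [fourierInv_eq_integral_planeWave]
        refine integral_congr_ae (ae_of_all _ fun ξ => ?_)
        simp only [hH, fourier_dilation_mul_planeWave k hε, smul_inv_smul₀ hε.ne',
          add_sub_cancel]
        ring
    _ = ((ε ^ Module.finrank ℝ V)⁻¹ : ℝ) * ∫ ξ, H (ε⁻¹ • (ξ - ξ₀)) := integral_const_mul _ _
    _ = _ := by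
        rw [h2, h1, ← mul_assoc, ← Complex.ofReal_mul, inv_mul_cancel₀ hε', Complex.ofReal_one,
          one_mul]

/-- Fourier multipliers of quadratic growth act on plane waves with a slowly varying amplitude
asymptotically as multiplication by the symbol. -/
theorem fourierInv_mul_fourier_planeWave_bound {m : V → ℂ} {K : ℝ}
    (hK : ∀ ξ, ‖m ξ‖ ≤ K * (1 + (2 * Real.pi * ‖ξ‖) ^ 2)) (k : SchwartzMap V ℂ) (ξ₀ : V) :
    ∃ B : ℝ, ∀ ε : ℝ, 0 < ε → ε ≤ 1 → ∀ x,
      ‖𝓕⁻ (fun ξ => m ξ * 𝓕 (fun x => k (ε • x) * planeWave ξ₀ x) ξ) x‖ ≤ B := by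
  have hK0 : 0 ≤ K := by
    have := (norm_nonneg _).trans (hK 0)
    simpa using this
  set A : ℝ := K * (1 + 2 * (2 * Real.pi * ‖ξ₀‖) ^ 2 + 2)
  refine ⟨∫ η, A * ((1 + (2 * Real.pi * ‖η‖) ^ 2) * ‖𝓕 (k : V → ℂ) η‖), fun ε hε hε1 x => ?_⟩
  rw [fourierInv_mul_fourier_dilation_mul_planeWave m k hε]
  refine norm_integral_le_of_norm_le
    ((integrable_one_add_norm_sq_mul_fourier k).const_mul A) (ae_of_all _ fun η => ?_)
  rw [norm_mul, norm_planeWave, one_mul, norm_mul, ← mul_assoc]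
  refine mul_le_mul_of_nonneg_right ((hK _).trans ?_) (norm_nonneg _)
  simpa only [A, mul_assoc K] using
        mul_le_mul_of_nonneg_left (norm_add_sq_le_of_le_one hε hε1 ξ₀ η) hK0

/-- After the substitution ξ = ξ₀ + εη the symbol freezes at ξ₀ by dominated convergence, and ∫ 𝓕 k
= k(0) by inversion. -/
theorem tendsto_fourierInv_mul_fourier_planeWave {m : V → ℂ} (hm : Continuous m) {K : ℝ}
    (hK : ∀ ξ, ‖m ξ‖ ≤ K * (1 + (2 * Real.pi * ‖ξ‖) ^ 2)) (k : SchwartzMap V ℂ) (ξ₀ x : V) :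
    Tendsto (fun ε : ℝ => 𝓕⁻ (fun ξ => m ξ * 𝓕 (fun x => k (ε • x) * planeWave ξ₀ x) ξ) x)
      (𝓝[>] 0) (𝓝 (m ξ₀ * planeWave ξ₀ x * k 0)) := by
  have hK0 : 0 ≤ K := by
    have := (norm_nonneg _).trans (hK 0)
    simpa using this
  set A : ℝ := K * (1 + 2 * (2 * Real.pi * ‖ξ₀‖) ^ 2 + 2)
  have hlim : m ξ₀ * planeWave ξ₀ x * k 0 =
      ∫ η, planeWave x (ξ₀ + (0 : ℝ) • η) * (m (ξ₀ + (0 : ℝ) • η) * 𝓕 (k : V → ℂ) η) := by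
    simp only [zero_smul, add_zero, integral_const_mul]
    have h1 : 𝓕⁻ (𝓕 (k : V → ℂ)) 0 = k 0 := by
      rw [← SchwartzMap.fourier_coe, ← SchwartzMap.fourierInv_coe,
        FourierTransform.fourierInv_fourier_eq]
    rw [← h1, fourierInv_eq_integral_planeWave]
    simp only [planeWave, inner_zero_right, AddChar.map_zero_eq_one, Circle.coe_one, one_mul]
    rw [real_inner_comm]
    ring
  rw [hlim]
  have hcont : Continuous (𝓕 (k : V → ℂ)) := (𝓕 k).continuous
  refine Tendsto.congr' (f₁ := fun ε : ℝ =>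
    ∫ η, planeWave x (ξ₀ + ε • η) * (m (ξ₀ + ε • η) * 𝓕 (k : V → ℂ) η)) ?_ ?_
  · filter_upwards [self_mem_nhdsWithin] with ε hε
    exact (fourierInv_mul_fourier_dilation_mul_planeWave m k hε ξ₀ x).symm
  · refine tendsto_integral_filter_of_dominated_convergence
      (fun η => A * ((1 + (2 * Real.pi * ‖η‖) ^ 2) * ‖𝓕 (k : V → ℂ) η‖)) ?_ ?_
      ((integrable_one_add_norm_sq_mul_fourier k).const_mul A) (ae_of_all _ fun η => ?_)
    · refine Eventually.of_forall fun ε => Continuous.aestronglyMeasurable ?_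
      refine (continuous_planeWave.comp (by fun_prop : Continuous fun η => (x, ξ₀ + ε • η))).mul ?_
      exact (hm.comp (by fun_prop)).mul hcont
    · filter_upwards [Ioc_mem_nhdsGT one_pos] with ε hε
      refine ae_of_all _ fun η => ?_
      rw [norm_mul, norm_planeWave, one_mul, norm_mul, ← mul_assoc]
      refine mul_le_mul_of_nonneg_right ((hK _).trans ?_) (norm_nonneg _)
      simpa only [A, mul_assoc K] using
        mul_le_mul_of_nonneg_left (norm_add_sq_le_of_le_one hε.1 hε.2 ξ₀ η) hK0
    · refine Tendsto.mono_left ?_ nhdsWithin_le_nhds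
      have : Continuous fun ε : ℝ =>
          planeWave x (ξ₀ + ε • η) * (m (ξ₀ + ε • η) * 𝓕 (k : V → ℂ) η) := by
        refine (continuous_planeWave.comp
          (by fun_prop : Continuous fun ε : ℝ => (x, ξ₀ + ε • η))).mul ?_
        exact (hm.comp (by fun_prop)).mul continuous_const
      exact this.tendsto 0

end ModulatedDilation

/-! ### Continuity, sign and growth of the symbol. -/

section Symbol

variable {V : Type*} [NormedAddCommGroup V]

theorem IsBernsteinFunction.continuous_symbol {Ψ : ℝ → ℝ} (h : IsBernsteinFunction Ψ) :
    Continuous fun ξ : V => Ψ ((2 * Real.pi * ‖ξ‖) ^ 2) :=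
  h.continuousOn.comp_continuous (by fun_prop) fun ξ => by simp only [mem_Ici]; positivity

theorem IsBernsteinFunction.symbol_nonneg {Ψ : ℝ → ℝ} (h : IsBernsteinFunction Ψ) (ξ : V) :
    0 ≤ Ψ ((2 * Real.pi * ‖ξ‖) ^ 2) :=
  h.nonneg _ (by positivity)

theorem norm_symbol_le {Ψ : ℝ → ℝ} {μ : Measure ℝ} (h : IsBernsteinFunction Ψ)
    (hμ : HasLevyKhintchineRepr Ψ 0 0 μ) (ξ : V) :
    ‖(Ψ ((2 * Real.pi * ‖ξ‖) ^ 2) : ℂ)‖ ≤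
      (∫ t in Ioi 0, min 1 t ∂μ) * (1 + (2 * Real.pi * ‖ξ‖) ^ 2) := by
  rw [Complex.norm_real, Real.norm_of_nonneg (h.symbol_nonneg ξ)]
  exact hμ.le_mul_one_add (by positivity)

end Symbol

/-! ### Real compactly supported approximations of waves. -/

section ModulatedCutoff

variable {V : Type*} [NormedAddCommGroup V] [InnerProductSpace ℝ V]

/-- The wave `cos(2π⟨x, ξ⟩ + θ)` with amplitude `k(εx)`. -/
noncomputable def modulatedCutoff (k : V → ℝ) (ξ : V) (θ ε : ℝ) (x : V) : ℝ :=
  k (ε • x) * Real.cos (2 * Real.pi * inner ℝ x ξ + θ)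

variable {k : V → ℝ}

theorem contDiff_modulatedCutoff (hk : ContDiff ℝ (⊤ : ℕ∞) k) (ξ : V) (θ ε : ℝ) :
    ContDiff ℝ (⊤ : ℕ∞) (modulatedCutoff k ξ θ ε) := by
  unfold modulatedCutoff
  exact (hk.comp (by fun_prop)).mul (Real.contDiff_cos.comp
    ((contDiff_const.mul (contDiff_id.inner ℝ contDiff_const)).add contDiff_const))

theorem hasCompactSupport_modulatedCutoff (hk : HasCompactSupport k) (ξ : V) (θ : ℝ) {ε : ℝ}
    (hε : ε ≠ 0) : HasCompactSupport (modulatedCutoff k ξ θ ε) :=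
  (hk.comp_smul hε).mul_right

theorem fderiv_modulatedCutoff (hk : ContDiff ℝ (⊤ : ℕ∞) k) (ξ : V) (θ ε : ℝ) (x v : V) :
    fderiv ℝ (modulatedCutoff k ξ θ ε) x v =
      ε * fderiv ℝ k (ε • x) v * Real.cos (2 * Real.pi * inner ℝ x ξ + θ) -
        k (ε • x) * (2 * Real.pi * inner ℝ v ξ * Real.sin (2 * Real.pi * inner ℝ x ξ + θ)) := by
  have h1 : HasFDerivAt (fun x : V => k (ε • x))
      ((fderiv ℝ k (ε • x)).comp (ε • ContinuousLinearMap.id ℝ V)) x :=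
    ((hk.differentiable (by simp)) (ε • x)).hasFDerivAt.comp x ((hasFDerivAt_id x).const_smul ε)
  have h2 : HasFDerivAt (fun x : V => 2 * Real.pi * inner ℝ x ξ + θ)
      ((2 * Real.pi) • (innerSL ℝ).flip ξ) x :=
    (((innerSL ℝ).flip ξ).hasFDerivAt.const_mul (2 * Real.pi)).add_const θ
  have h3 := h1.fun_mul h2.cos
  have h4 : fderiv ℝ (modulatedCutoff k ξ θ ε) x = _ := h3.fderiv
  rw [h4]
  have h5 : (innerSL ℝ).flip ξ v = inner ℝ v ξ := rfl
  simp only [add_apply, smul_apply, h5, smul_eq_mul,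
    ContinuousLinearMap.comp_apply, ContinuousLinearMap.id_apply, map_smul]
  ring

variable [FiniteDimensional ℝ V] [MeasurableSpace V] [BorelSpace V]

/-- The cosine is split into its two conjugate exponentials, because admissible test functions are
real while the asymptotics are for complex plane waves. -/
theorem fourierInv_mul_fourier_modulatedCutoff (hk : ContDiff ℝ (⊤ : ℕ∞) k)
    (hks : HasCompactSupport k) {m : V → ℂ} (hm : Continuous m) {K : ℝ}
    (hK : ∀ ξ, ‖m ξ‖ ≤ K * (1 + (2 * Real.pi * ‖ξ‖) ^ 2)) (ξ : V) (θ : ℝ) {ε : ℝ} (hε : ε ≠ 0)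
    (x : V) :
    𝓕⁻ (fun η => m η * 𝓕 (fun z => (modulatedCutoff k ξ θ ε z : ℂ)) η) x =
      (1 / 2 * Complex.exp (θ * Complex.I)) *
        𝓕⁻ (fun η => m η * 𝓕 (fun z => (k (ε • z) : ℂ) * planeWave ξ z) η) x +
      (1 / 2 * Complex.exp (-θ * Complex.I)) *
        𝓕⁻ (fun η => m η * 𝓕 (fun z => (k (ε • z) : ℂ) * planeWave (-ξ) z) η) x := by
  have hs : ∀ ξ : V, ∃ g : SchwartzMap V ℂ,
      (g : V → ℂ) = fun z => (k (ε • z) : ℂ) * planeWave ξ z := fun ξ => by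
    have h1 : ContDiff ℝ (⊤ : ℕ∞) fun z => (k (ε • z) : ℂ) * planeWave ξ z := by
      simp only [planeWave_eq_exp]
      refine (Complex.ofRealCLM.contDiff.comp (hk.comp (by fun_prop))).mul ?_
      refine ContDiff.cexp (ContDiff.mul ?_ contDiff_const)
      exact Complex.ofRealCLM.contDiff.comp
        (contDiff_const.mul (contDiff_id.inner ℝ contDiff_const))
    have h2 : HasCompactSupport fun z => (k (ε • z) : ℂ) * planeWave ξ z :=
      HasCompactSupport.mul_right ((hks.comp_smul hε).comp_left (g := Complex.ofReal) rfl)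
    exact ⟨h2.toSchwartzMap h1, rfl⟩
  have hi : ∀ g : SchwartzMap V ℂ, Integrable fun η => m η * 𝓕 (g : V → ℂ) η := fun g => by
    refine ((integrable_one_add_norm_sq_mul_fourier g).const_mul K).mono' ?_
      (ae_of_all _ fun η => ?_)
    · exact (hm.mul (𝓕 g).continuous).aestronglyMeasurable
    · rw [norm_mul, ← mul_assoc]
      exact mul_le_mul_of_nonneg_right (hK η) (norm_nonneg _)
  obtain ⟨g₁, h₁⟩ := hs ξ
  obtain ⟨g₂, h₂⟩ := hs (-ξ)
  rw [← h₁, ← h₂, ← fourierInv_linear_combination (hi g₁) (hi g₂)]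
  refine congrArg (fun F : V → ℂ => (𝓕⁻ F : V → ℂ) x) (funext fun η => ?_)
  have h3 : (fun z => (modulatedCutoff k ξ θ ε z : ℂ)) = fun z =>
      (1 / 2 * Complex.exp (θ * Complex.I)) * g₁ z +
        (1 / 2 * Complex.exp (-θ * Complex.I)) * g₂ z := by
    ext z
    rw [h₁, h₂]
    simp only [modulatedCutoff, planeWave_eq_exp, inner_neg_right, Complex.ofReal_mul,
      Complex.ofReal_cos, Complex.cos]
    have e1 : Complex.exp (((2 * Real.pi * inner ℝ z ξ + θ : ℝ) : ℂ) * Complex.I) =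
        Complex.exp (θ * Complex.I) *
          Complex.exp (((2 * Real.pi * inner ℝ z ξ : ℝ) : ℂ) * Complex.I) := by
      rw [← Complex.exp_add]; congr 1; push_cast; ring
    have e2 : Complex.exp (-((2 * Real.pi * inner ℝ z ξ + θ : ℝ) : ℂ) * Complex.I) =
        Complex.exp (-θ * Complex.I) *
          Complex.exp (((2 * Real.pi * -inner ℝ z ξ : ℝ) : ℂ) * Complex.I) := by
      rw [← Complex.exp_add]; congr 1; push_cast; ring
    rw [e1, e2]
    push_cast
    ring
  rw [h3, fourier_linear_combination g₁.integrable g₂.integrable]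
  ring

end ModulatedCutoff

/-! ### Ψ(-Δ) on test functions and on modulated cutoffs. -/

section PsiLaplacian

variable {d : ℕ} {Ψ : ℝ → ℝ} {μ : Measure ℝ} {k : EuclideanSpace ℝ (Fin d) → ℝ}

theorem psiLaplacian_eq_schwartz {f : EuclideanSpace ℝ (Fin d) → ℝ} (hf : ContDiff ℝ (⊤ : ℕ∞) f)
    (hfs : HasCompactSupport f) : ∃ g : SchwartzMap (EuclideanSpace ℝ (Fin d)) ℂ,
      (∀ x, g x = f x) ∧ psiLaplacian Ψ f = fun x =>
        (𝓕⁻ (fun ξ => (Ψ ((2 * Real.pi * ‖ξ‖) ^ 2) : ℂ) *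
          𝓕 (g : EuclideanSpace ℝ (Fin d) → ℂ) ξ) x).re := by
  have h1 : HasCompactSupport fun z => (f z : ℂ) := hfs.comp_left (g := Complex.ofReal) rfl
  have h2 : ContDiff ℝ (⊤ : ℕ∞) fun z => (f z : ℂ) := Complex.ofRealCLM.contDiff.comp hf
  exact ⟨h1.toSchwartzMap h2, fun x => rfl, rfl⟩

theorem integrable_psiLaplacian (hμ : HasLevyKhintchineRepr Ψ 0 0 μ)
    {f : EuclideanSpace ℝ (Fin d) → ℝ} (hf : ContDiff ℝ (⊤ : ℕ∞) f)
    (hfs : HasCompactSupport f) : Integrable (psiLaplacian Ψ f) := by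
  obtain ⟨g, -, hg⟩ := psiLaplacian_eq_schwartz (Ψ := Ψ) hf hfs
  rw [hg]
  exact (hμ.integrable_fourierInv_mul_fourier g).re

theorem continuous_psiLaplacian (hΨ : IsBernsteinFunction Ψ) (hμ : HasLevyKhintchineRepr Ψ 0 0 μ)
    {f : EuclideanSpace ℝ (Fin d) → ℝ} (hf : ContDiff ℝ (⊤ : ℕ∞) f)
    (hfs : HasCompactSupport f) : Continuous (psiLaplacian Ψ f) := by
  obtain ⟨g, -, hg⟩ := psiLaplacian_eq_schwartz (Ψ := Ψ) hf hfs
  rw [hg]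
  refine Complex.continuous_re.comp (continuous_fourierInv_of_integrable ?_)
  refine ((integrable_one_add_norm_sq_mul_fourier g).const_mul (∫ t in Ioi 0, min 1 t ∂μ)).mono' ?_
    (ae_of_all _ fun η => ?_)
  · exact ((Complex.continuous_ofReal.comp hΨ.continuous_symbol).mul
      (𝓕 g).continuous).aestronglyMeasurable
  · rw [norm_mul, ← mul_assoc]
    exact mul_le_mul_of_nonneg_right (norm_symbol_le hΨ hμ η) (norm_nonneg _)

theorem psiLaplacian_const_mul (c : ℝ) (f : EuclideanSpace ℝ (Fin d) → ℝ)
    (x : EuclideanSpace ℝ (Fin d)) :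
    psiLaplacian Ψ (fun z => c * f z) x = c * psiLaplacian Ψ f x := by
  unfold psiLaplacian
  have h1 : ∀ ξ, 𝓕 (fun z => ((c * f z : ℝ) : ℂ)) ξ = c * 𝓕 (fun z => (f z : ℂ)) ξ := fun ξ => by
    rw [Real.fourier_eq, Real.fourier_eq, ← integral_const_mul]
    refine integral_congr_ae (ae_of_all _ fun z => ?_)
    simp only [Circle.smul_def, smul_eq_mul]
    push_cast
    ring
  simp only [h1]
  rw [← Complex.re_ofReal_mul, fourierInv_eq_integral_planeWave, fourierInv_eq_integral_planeWave,
    ← integral_const_mul]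
  congr 1
  refine integral_congr_ae (ae_of_all _ fun z => ?_)
  ring

/-- Uniformity in ε and x supplies the majorant when the cutoff is removed under an integral against
an L¹ function. -/
theorem exists_psiLaplacian_modulatedCutoff_le (hΨ : IsBernsteinFunction Ψ)
    (hμ : HasLevyKhintchineRepr Ψ 0 0 μ) (hk : ContDiff ℝ (⊤ : ℕ∞) k) (hks : HasCompactSupport k)
    (ξ : EuclideanSpace ℝ (Fin d)) (θ : ℝ) :
    ∃ B : ℝ, ∀ ε : ℝ, 0 < ε → ε ≤ 1 → ∀ x,
      |psiLaplacian Ψ (modulatedCutoff k ξ θ ε) x| ≤ B := by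
  have h1 : HasCompactSupport fun z => (k z : ℂ) := hks.comp_left (g := Complex.ofReal) rfl
  have h2 : ContDiff ℝ (⊤ : ℕ∞) fun z => (k z : ℂ) := Complex.ofRealCLM.contDiff.comp hk
  have hm := Complex.continuous_ofReal.comp
    (hΨ.continuous_symbol (V := EuclideanSpace ℝ (Fin d)))
  obtain ⟨B₁, hB₁⟩ := fourierInv_mul_fourier_planeWave_bound (norm_symbol_le hΨ hμ)
    (h1.toSchwartzMap h2) ξ
  obtain ⟨B₂, hB₂⟩ := fourierInv_mul_fourier_planeWave_bound (norm_symbol_le hΨ hμ)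
    (h1.toSchwartzMap h2) (-ξ)
  refine ⟨B₁ + B₂, fun ε hε hε1 x => (Complex.abs_re_le_norm _).trans ?_⟩
  have := fourierInv_mul_fourier_modulatedCutoff hk hks hm (norm_symbol_le hΨ hμ) ξ θ hε.ne' x
  simp only [Function.comp_def] at this
  rw [this]
  have n1 : ∀ r : ℝ, ‖(1 / 2 * Complex.exp (r * Complex.I))‖ = 1 / 2 := fun r => by
    rw [norm_mul, Complex.norm_exp_ofReal_mul_I]; norm_num
  have n2 := n1 (-θ)
  rw [Complex.ofReal_neg] at n2
  refine (norm_add_le _ _).trans ?_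
  rw [norm_mul, norm_mul _ (𝓕⁻ (fun η => (Ψ ((2 * Real.pi * ‖η‖) ^ 2) : ℂ) *
    𝓕 (fun z => (k (ε • z) : ℂ) * planeWave (-ξ) z) η) x), n1, n2]
  have b1 := hB₁ ε hε hε1 x
  have b2 := hB₂ ε hε hε1 x
  simp only [HasCompactSupport.toSchwartzMap_toFun] at b1 b2
  have := norm_nonneg (𝓕⁻ (fun η => (Ψ ((2 * Real.pi * ‖η‖) ^ 2) : ℂ) *
    𝓕 (fun z => (k (ε • z) : ℂ) * planeWave ξ z) η) x)
  have := norm_nonneg (𝓕⁻ (fun η => (Ψ ((2 * Real.pi * ‖η‖) ^ 2) : ℂ) *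
    𝓕 (fun z => (k (ε • z) : ℂ) * planeWave (-ξ) z) η) x)
  linarith

/-- The frequencies ξ and -ξ carry the same symbol value, so the two limiting exponentials recombine
into a cosine. -/
theorem tendsto_psiLaplacian_modulatedCutoff (hΨ : IsBernsteinFunction Ψ)
    (hμ : HasLevyKhintchineRepr Ψ 0 0 μ) (hk : ContDiff ℝ (⊤ : ℕ∞) k) (hks : HasCompactSupport k)
    (hk0 : k 0 = 1) (ξ : EuclideanSpace ℝ (Fin d)) (θ : ℝ) (x : EuclideanSpace ℝ (Fin d)) :
    Tendsto (fun ε => psiLaplacian Ψ (modulatedCutoff k ξ θ ε) x) (𝓝[>] 0)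
      (𝓝 (Ψ ((2 * Real.pi * ‖ξ‖) ^ 2) * Real.cos (2 * Real.pi * inner ℝ x ξ + θ))) := by
  have h1 : HasCompactSupport fun z => (k z : ℂ) := hks.comp_left (g := Complex.ofReal) rfl
  have h2 : ContDiff ℝ (⊤ : ℕ∞) fun z => (k z : ℂ) := Complex.ofRealCLM.contDiff.comp hk
  have hm := Complex.continuous_ofReal.comp
    (hΨ.continuous_symbol (V := EuclideanSpace ℝ (Fin d)))
  have t1 := tendsto_fourierInv_mul_fourier_planeWave hm (norm_symbol_le hΨ hμ)
    (h1.toSchwartzMap h2) ξ x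
  have t2 := tendsto_fourierInv_mul_fourier_planeWave hm (norm_symbol_le hΨ hμ)
    (h1.toSchwartzMap h2) (-ξ) x
  have t := (t1.const_mul (1 / 2 * Complex.exp (θ * Complex.I))).add
    (t2.const_mul (1 / 2 * Complex.exp (-θ * Complex.I)))
  have t' := (Complex.continuous_re.tendsto _).comp t
  have hlim : (1 / 2 * Complex.exp (θ * Complex.I) * (((fun r : ℝ => (r : ℂ)) ∘ fun ξ : EuclideanSpace ℝ (Fin d) => Ψ ((2 * Real.pi * ‖ξ‖) ^ 2)) ξ * planeWave ξ x * (h1.toSchwartzMap h2) 0) +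
      1 / 2 * Complex.exp (-θ * Complex.I) * (((fun r : ℝ => (r : ℂ)) ∘ fun ξ : EuclideanSpace ℝ (Fin d) => Ψ ((2 * Real.pi * ‖ξ‖) ^ 2)) (-ξ) * planeWave (-ξ) x * (h1.toSchwartzMap h2) 0)).re =
      Ψ ((2 * Real.pi * ‖ξ‖) ^ 2) * Real.cos (2 * Real.pi * inner ℝ x ξ + θ) := by
    have e : ∀ r s : ℝ, Complex.exp (r * Complex.I) * Complex.exp (s * Complex.I) =
        Complex.exp (((s + r : ℝ) : ℂ) * Complex.I) := fun r s => by
      rw [← Complex.exp_add]; congr 1; push_cast; ring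
    simp only [HasCompactSupport.toSchwartzMap_toFun, Function.comp_apply, hk0, norm_neg, planeWave_eq_exp,
      inner_neg_right, Complex.ofReal_one, mul_one]
    rw [← Complex.ofReal_neg]
    have : ∀ a b p q r : ℂ, 1 / 2 * a * (p * b) + 1 / 2 * q * (p * r) =
      p * ((1 / 2) * (a * b + q * r)) := fun a b p q r => by ring
    rw [this, e, e, Complex.re_ofReal_mul]
    have h : (1 / 2 : ℂ) = ((1 / 2 : ℝ) : ℂ) := by push_cast; rfl
    rw [h, Complex.re_ofReal_mul, Complex.add_re, Complex.exp_ofReal_mul_I_re,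
      Complex.exp_ofReal_mul_I_re]
    have : 2 * Real.pi * -inner ℝ x ξ + -θ = -(2 * Real.pi * inner ℝ x ξ + θ) := by ring
    rw [this, Real.cos_neg]
    ring
  rw [← hlim]
  refine t'.congr' ?_
  filter_upwards [self_mem_nhdsWithin] with ε hε
  have := fourierInv_mul_fourier_modulatedCutoff hk hks hm (norm_symbol_le hΨ hμ) ξ θ
    (ne_of_gt hε) x
  simp only [Function.comp_def] at this
  simp only [psiLaplacian, this, Function.comp_def, HasCompactSupport.toSchwartzMap_toFun]

end PsiLaplacian

/-! ### Primitives of integrable functions of time. -/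

section OneDimensional

theorem setIntegral_Ioo_eq_integral_indicator (h : ℝ → ℂ) {t T : ℝ} (ht : t ∈ Ioo 0 T) :
    ∫ s in Ioo 0 t, h s = ∫ s in Ioo 0 T, (Iio t).indicator h s := by
  rw [integral_indicator measurableSet_Iio, Measure.restrict_restrict measurableSet_Iio]
  congr 2
  ext s
  simp only [mem_Ioo, mem_inter_iff, mem_Iio]
  constructor
  · rintro ⟨h1, h2⟩; exact ⟨h2, h1, h2.trans ht.2⟩
  · rintro ⟨h1, h2, -⟩; exact ⟨h2, h1⟩

theorem primitive_mul_eq_integral_indicator (f g : ℝ → ℂ) {t T : ℝ} (ht : t ∈ Ioo 0 T) :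
    (∫ s in Ioo 0 t, f s) * g t =
      ∫ s in Ioo 0 T, {p : ℝ × ℝ | p.1 < p.2}.indicator (fun p => f p.1 * g p.2) (s, t) := by
  rw [setIntegral_Ioo_eq_integral_indicator f ht, ← integral_mul_const]
  refine integral_congr_ae (ae_of_all _ fun s => ?_)
  by_cases h : s < t <;> simp [indicator, h]

theorem integrableOn_primitive_mul {f g : ℝ → ℂ} {T : ℝ}
    (hf : IntegrableOn f (Ioo 0 T)) (hg : IntegrableOn g (Ioo 0 T)) :
    IntegrableOn (fun t => (∫ s in Ioo 0 t, f s) * g t) (Ioo 0 T) := by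
  have hfg := (hf.mul_prod hg).indicator
    (measurableSet_lt (measurable_fst (α := ℝ) (β := ℝ)) measurable_snd)
  refine hfg.integral_prod_right.congr ?_
  filter_upwards [ae_restrict_mem measurableSet_Ioo] with t ht
  exact (primitive_mul_eq_integral_indicator f g ht).symm

/-- Integration by parts for primitives of integrable functions. -/
theorem integral_mul_primitive_add {f g : ℝ → ℂ} {T : ℝ}
    (hf : IntegrableOn f (Ioo 0 T)) (hg : IntegrableOn g (Ioo 0 T)) :
    (∫ t in Ioo 0 T, f t * ∫ s in Ioo 0 t, g s) + (∫ t in Ioo 0 T, (∫ s in Ioo 0 t, f s) * g t) =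
      (∫ t in Ioo 0 T, f t) * ∫ t in Ioo 0 T, g t := by
  set ν : Measure ℝ := volume.restrict (Ioo 0 T) with hν
  have hfg : Integrable (fun p : ℝ × ℝ => f p.1 * g p.2) (ν.prod ν) := hf.mul_prod hg
  have hlow : MeasurableSet {p : ℝ × ℝ | p.2 < p.1} := measurableSet_lt measurable_snd measurable_fst
  have hupp : MeasurableSet {p : ℝ × ℝ | p.1 < p.2} := measurableSet_lt measurable_fst measurable_snd
  have e1 : ∫ t in Ioo 0 T, f t * ∫ s in Ioo 0 t, g s =
      ∫ p, {p : ℝ × ℝ | p.2 < p.1}.indicator (fun p => f p.1 * g p.2) p ∂(ν.prod ν) := by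
    rw [integral_prod _ (hfg.indicator hlow)]
    refine setIntegral_congr_fun measurableSet_Ioo fun t ht => ?_
    rw [mul_comm, primitive_mul_eq_integral_indicator g f ht]
    refine integral_congr_ae (ae_of_all _ fun s => ?_)
    by_cases h : s < t <;> simp [indicator, h, mul_comm]
  have e2 : ∫ t in Ioo 0 T, (∫ s in Ioo 0 t, f s) * g t =
      ∫ p, {p : ℝ × ℝ | p.1 < p.2}.indicator (fun p => f p.1 * g p.2) p ∂(ν.prod ν) := by
    rw [integral_prod_symm _ (hfg.indicator hupp)]
    exact setIntegral_congr_fun measurableSet_Ioo fun t ht =>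
      primitive_mul_eq_integral_indicator f g ht
  rw [e1, e2, ← integral_add (hfg.indicator hlow) (hfg.indicator hupp), ← integral_prod_mul]
  refine integral_congr_ae ?_
  -- The two open triangles fill the square up to the diagonal, which is a null set.
  have hdiag : ∀ᵐ p ∂(ν.prod ν), p ∈ {p : ℝ × ℝ | p.1 = p.2}ᶜ := by
    refine (Measure.ae_prod_mem_iff_ae_ae_mem
      (measurableSet_eq_fun measurable_fst measurable_snd).compl).2 ?_
    refine ae_of_all _ fun t => ?_
    have : ∀ᵐ s ∂ν, s ≠ t := Measure.ae_ne ν t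
    filter_upwards [this] with s hs using hs.symm
  filter_upwards [hdiag] with p hp
  rcases lt_or_gt_of_ne (show p.1 ≠ p.2 from hp) with h | h
  · simp [indicator, h, h.le]
  · simp [indicator, h, h.le]

/-- The integrated form of (|G|²)' = 2 Re(conj G · G') for a primitive G. It follows from
integration by parts with the pair conj g, g, so G need not be differentiated. -/
theorem norm_sq_primitive {g : ℝ → ℂ} {T : ℝ} (hg : IntegrableOn g (Ioo 0 T)) :
    ‖∫ t in Ioo 0 T, g t‖ ^ 2 =
      ∫ t in Ioo 0 T, 2 * (starRingEnd ℂ (∫ s in Ioo 0 t, g s) * g t).re := by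
  have hc : IntegrableOn (fun t => starRingEnd ℂ (g t)) (Ioo 0 T) :=
    Complex.conjCLE.toContinuousLinearMap.integrable_comp hg
  have h := integral_mul_primitive_add hc hg
  have hi := integrableOn_primitive_mul hc hg
  simp only [integral_conj] at h hi
  set X := ∫ t in Ioo 0 T, (starRingEnd ℂ) (∫ s in Ioo 0 t, g s) * g t with hX
  have hXc : ∫ t in Ioo 0 T, (starRingEnd ℂ) (g t) * ∫ s in Ioo 0 t, g s = starRingEnd ℂ X := by
    rw [hX, ← integral_conj]
    refine integral_congr_ae (ae_of_all _ fun t => ?_)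
    simp [mul_comm]
  rw [hXc, Complex.conj_mul'] at h
  have h2 := congrArg Complex.re h
  rw [← Complex.ofReal_pow, Complex.ofReal_re, Complex.add_re, Complex.conj_re] at h2
  rw [← h2, integral_const_mul]
  have h3 : X.re = ∫ t in Ioo 0 T, (starRingEnd ℂ (∫ s in Ioo 0 t, g s) * g t).re :=
    (Complex.reCLM.integral_comp_comm hi).symm
  rw [← h3]
  ring

/-- The lemma of du Bois-Reymond with vanishing initial value. -/
theorem ae_eq_primitive_of_weak {f g : ℝ → ℂ} {T : ℝ} (hT : 0 < T)
    (hf : IntegrableOn f (Ioo 0 T)) (hg : IntegrableOn g (Ioo 0 T))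
    (h : ∀ χ : ℝ → ℝ, ContDiff ℝ (⊤ : ℕ∞) χ → HasCompactSupport χ → tsupport χ ⊆ Iio T →
      ∫ t in Ioo 0 T, (((deriv χ t : ℝ) : ℂ) * f t + (χ t : ℂ) * g t) = 0) :
    ∀ᵐ t ∂(volume.restrict (Ioo 0 T)), f t = ∫ s in Ioo 0 t, g s := by
  have hG : IntegrableOn (fun t => ∫ s in Ioo 0 t, g s) (Ioo 0 T) := by
    have := integrableOn_primitive_mul hg (g := fun _ => 1) (by simp)
    simpa using this
  suffices H : ∀ᵐ t, t ∈ Ioo 0 T → f t - ∫ s in Ioo 0 t, g s = 0 by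
    rw [ae_restrict_iff' measurableSet_Ioo]
    exact H.mono fun t ht htT => sub_eq_zero.1 (ht htT)
  refine isOpen_Ioo.ae_eq_zero_of_integral_contDiff_smul_eq_zero
    ((hf.sub hG).locallyIntegrableOn) ?_
  intro θ hθ hθs hθT
  have hθc : Continuous θ := hθ.continuous
  obtain ⟨ε, hε, hεθ⟩ : ∃ ε > 0, ∀ t, T - ε < t → θ t = 0 := by
    have h1 : (tsupport θ)ᶜ ∈ 𝓝 T :=
      (isClosed_tsupport θ).isOpen_compl.mem_nhds fun hh => lt_irrefl _ (hθT hh).2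
    obtain ⟨ε, hε, hb⟩ := Metric.mem_nhds_iff.1 h1
    refine ⟨ε, hε, fun t ht => ?_⟩
    refine image_eq_zero_of_notMem_tsupport fun hmem => ?_
    refine hb ?_ hmem
    rw [Metric.mem_ball, Real.dist_eq, abs_lt]
    have := (hθT hmem).2
    constructor <;> linarith
  set c := ∫ s in (0 : ℝ)..T, θ s with hc
  -- The primitive of θ is normalised to vanish near T, not at 0. Its possibly nonzero value at 0 is
  -- what forces the zero initial value of f.
  set Θ : ℝ → ℝ := fun t => (∫ s in (0 : ℝ)..t, θ s) - c with hΘ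
  have hΘd : ∀ t, HasDerivAt Θ (θ t) t := fun t =>
    (intervalIntegral.integral_hasDerivAt_right (hθc.intervalIntegrable _ _)
      (hθc.stronglyMeasurableAtFilter _ _) hθc.continuousAt).sub_const c
  have hΘs : ContDiff ℝ (⊤ : ℕ∞) Θ := by
    rw [contDiff_infty_iff_deriv]
    refine ⟨fun t => (hΘd t).differentiableAt, ?_⟩
    have : deriv Θ = θ := funext fun t => (hΘd t).deriv
    rwa [this]
  have hΘ0 : ∀ t, T - ε < t → Θ t = 0 := fun t ht => by
    have h1 : Θ t = ∫ s in T..t, θ s := by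
      rw [hΘ, hc]
      exact intervalIntegral.integral_interval_sub_left (hθc.intervalIntegrable _ _)
        (hθc.intervalIntegrable _ _)
    rw [h1]
    refine intervalIntegral.integral_zero_ae (ae_of_all _ fun s hs => hεθ s ?_)
    rw [mem_uIoc] at hs
    rcases hs with hs | hs
    · linarith [hs.1]
    · linarith [hs.1]
  -- Θ may be a nonzero constant for negative times; the bump makes the support compact and equals 1
  -- on (0,T).
  let η : ContDiffBump (0 : ℝ) := ⟨T, 2 * T, hT, by linarith⟩
  have hη1 : ∀ t ∈ Ioo 0 T, η t = 1 := fun t ht => η.one_of_mem_closedBall (by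
    rw [mem_closedBall_zero_iff, Real.norm_eq_abs, abs_of_pos ht.1]; exact ht.2.le)
  have hχs : tsupport (fun t => η t * Θ t) ⊆ Iio T := by
    have : tsupport (fun t => η t * Θ t) ⊆ Iic (T - ε) := by
      refine closure_minimal (fun t ht => ?_) isClosed_Iic
      by_contra hlt
      rw [mem_Iic, not_le] at hlt
      exact ht (by simp [hΘ0 t hlt])
    exact this.trans fun t ht => lt_of_le_of_lt (mem_Iic.1 ht) (sub_lt_self T hε)
  have key := h (fun t => η t * Θ t) (η.contDiff.mul hΘs) η.hasCompactSupport.mul_right hχs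
  have hθi : IntegrableOn (fun t => (θ t : ℂ)) (Ioo 0 T) :=
    ((Complex.continuous_ofReal.comp hθc).continuousOn.integrableOn_Icc (a := 0) (b := T)).mono_set
      Ioo_subset_Icc_self
  have hprim : ∀ t, 0 ≤ t → ∫ s in Ioo 0 t, (θ s : ℂ) = ((∫ s in (0 : ℝ)..t, θ s : ℝ) : ℂ) :=
    fun t ht => by
      rw [intervalIntegral.integral_of_le ht, integral_Ioc_eq_integral_Ioo, integral_complex_ofReal]
  have hparts := integral_mul_primitive_add hθi hg
  have hi1 : IntegrableOn (fun t => (θ t : ℂ) * f t) (Ioo 0 T) := by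
    obtain ⟨C, hC⟩ := hθs.exists_bound_of_continuous hθc
    exact hf.bdd_mul (c := C) (Complex.continuous_ofReal.comp hθc).aestronglyMeasurable
      (ae_of_all _ fun t => by simpa using hC t)
  have hi2 : IntegrableOn (fun t => (θ t : ℂ) * ∫ s in Ioo 0 t, g s) (Ioo 0 T) := by
    simpa only [mul_comm] using integrableOn_primitive_mul hg hθi
  have hi3 := integrableOn_primitive_mul hθi hg
  have hi4 : IntegrableOn (fun t => (∫ s in Ioo 0 t, (θ s : ℂ)) * g t -
      (∫ t in Ioo 0 T, (θ t : ℂ)) * g t) (Ioo 0 T) := hi3.sub (hg.const_mul _)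
  have key2 : (∫ t in Ioo 0 T, (θ t : ℂ) * f t) +
      ((∫ t in Ioo 0 T, (∫ s in Ioo 0 t, (θ s : ℂ)) * g t) -
        (∫ t in Ioo 0 T, (θ t : ℂ)) * ∫ t in Ioo 0 T, g t) = 0 := by
    rw [← integral_const_mul, ← integral_sub hi3 (hg.const_mul _),
      ← integral_add hi1 hi4, ← key]
    refine setIntegral_congr_fun measurableSet_Ioo fun t ht => ?_
    have hd : deriv (fun t => η t * Θ t) t = θ t := by
      have : (fun t => η t * Θ t) =ᶠ[𝓝 t] Θ := by
        filter_upwards [isOpen_Ioo.mem_nhds ht] with s hs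
        rw [hη1 s hs, one_mul]
      rw [this.deriv_eq, (hΘd t).deriv]
    rw [hd, hη1 t ht, one_mul, hprim t ht.1.le, hprim T hT.le, ← hc, hΘ, ← sub_mul]
    push_cast
    ring
  rw [← hparts] at key2
  have hfin : ∫ t in Ioo 0 T, ((θ t : ℂ) * f t - (θ t : ℂ) * ∫ s in Ioo 0 t, g s) = 0 := by
    rw [integral_sub hi1 hi2]
    linear_combination key2
  rw [← hfin, ← setIntegral_eq_integral_of_forall_compl_eq_zero (s := Ioo 0 T)]
  · refine integral_congr_ae (ae_of_all _ fun t => ?_)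
    simp only [Complex.real_smul, mul_sub]
  · intro t ht
    rw [image_eq_zero_of_notMem_tsupport fun hmem => ht (hθT hmem), zero_smul]

end OneDimensional

/-! ### From the weak equation to an evolution equation for each Fourier mode. -/

section TensorSolution

variable {d : ℕ} {T : ℝ} {Ψ : ℝ → ℝ} {μ : Measure ℝ}

/-- The system `∂ₜw₀ + Ψ(-Δ)w₁ + div v = 0`, `w₀(0) = 0`, tested against tensor products
`χ(t)ψ(x)`. -/
def IsTensorSolution {d : ℕ} (T : ℝ) (Ψ : ℝ → ℝ) (w₀ w₁ : ℝ × EuclideanSpace ℝ (Fin d) → ℝ)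
    (v : Fin d → ℝ × EuclideanSpace ℝ (Fin d) → ℝ) : Prop :=
  ∀ (χ : ℝ → ℝ) (ψ : EuclideanSpace ℝ (Fin d) → ℝ), ContDiff ℝ (⊤ : ℕ∞) χ →
    HasCompactSupport χ → tsupport χ ⊆ Iio T → ContDiff ℝ (⊤ : ℕ∞) ψ → HasCompactSupport ψ →
    ∫ p, (w₀ p * (deriv χ p.1 * ψ p.2) - w₁ p * (χ p.1 * psiLaplacian Ψ ψ p.2) +
      ∑ j, v j p * (χ p.1 * fderiv ℝ ψ p.2 (EuclideanSpace.single j 1))) ∂(spaceTimeMeasure d T) = 0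

variable {w₀ w₁ : ℝ × EuclideanSpace ℝ (Fin d) → ℝ} {v : Fin d → ℝ × EuclideanSpace ℝ (Fin d) → ℝ}

/-- Waves are not compactly supported, so the equation is tested with modulated cutoffs and ε → 0.
Integrability of w₀, w₁, v and the bounds uniform in ε justify dominated convergence; the gradient
falling on the cutoff carries a factor ε and disappears. -/
theorem IsTensorSolution.integral_mul_cos_sub_mul_sin (h : IsTensorSolution T Ψ w₀ w₁ v)
    (hΨ : IsBernsteinFunction Ψ) (hμ : HasLevyKhintchineRepr Ψ 0 0 μ)
    (hw₀ : Integrable w₀ (spaceTimeMeasure d T)) (hw₁ : Integrable w₁ (spaceTimeMeasure d T))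
    (hv : ∀ j, Integrable (v j) (spaceTimeMeasure d T)) {χ : ℝ → ℝ}
    (hχ : ContDiff ℝ (⊤ : ℕ∞) χ) (hχs : HasCompactSupport χ) (hχT : tsupport χ ⊆ Iio T)
    (ξ : EuclideanSpace ℝ (Fin d)) (θ : ℝ) :
    ∫ p, ((w₀ p * deriv χ p.1 - w₁ p * (χ p.1 * Ψ ((2 * Real.pi * ‖ξ‖) ^ 2))) *
        Real.cos (2 * Real.pi * inner ℝ p.2 ξ + θ) -
      (∑ j, v j p * (χ p.1 * (2 * Real.pi * ξ j))) *
        Real.sin (2 * Real.pi * inner ℝ p.2 ξ + θ)) ∂(spaceTimeMeasure d T) = 0 := by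
  let kb : ContDiffBump (0 : EuclideanSpace ℝ (Fin d)) := ⟨1, 2, one_pos, one_lt_two⟩
  set k : EuclideanSpace ℝ (Fin d) → ℝ := fun x => kb x with hkdef
  have hk : ContDiff ℝ (⊤ : ℕ∞) k := kb.contDiff
  have hks : HasCompactSupport k := kb.hasCompactSupport
  have hk0 : k 0 = 1 := kb.one_of_mem_closedBall (by simp [kb])
  obtain ⟨Ck, hCk⟩ := hks.exists_bound_of_continuous hk.continuous
  have hkd : Continuous (fderiv ℝ k) := hk.continuous_fderiv (by simp)
  obtain ⟨Cd, hCd⟩ := (hks.fderiv (𝕜 := ℝ)).exists_bound_of_continuous hkd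
  obtain ⟨Cχ, hCχ⟩ := hχs.exists_bound_of_continuous hχ.continuous
  have hχ' : Continuous (deriv χ) := hχ.continuous_deriv (by simp)
  obtain ⟨Cχ', hCχ'⟩ := hχs.deriv.exists_bound_of_continuous hχ'
  obtain ⟨B, hB⟩ := exists_psiLaplacian_modulatedCutoff_le hΨ hμ hk hks ξ θ
  have hCk0 : 0 ≤ Ck := (norm_nonneg _).trans (hCk 0)
  have hCd0 : 0 ≤ Cd := (norm_nonneg _).trans (hCd 0)
  have hCχ0 : 0 ≤ Cχ := (norm_nonneg _).trans (hCχ 0)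
  have hB0 : 0 ≤ B := (abs_nonneg _).trans (hB 1 one_pos le_rfl 0)
  set e : Fin d → EuclideanSpace ℝ (Fin d) := fun j => EuclideanSpace.single j 1 with he
  have hein : ∀ j, inner ℝ (e j) ξ = ξ j := fun j => by
    simp [he, EuclideanSpace.inner_single_left]
  have hen : ∀ j, ‖e j‖ = 1 := fun j => by simp [he]
  have hψb : ∀ ε x, |modulatedCutoff k ξ θ ε x| ≤ Ck := fun ε x => by
    rw [modulatedCutoff, abs_mul]
    exact (mul_le_of_le_one_right (abs_nonneg _) (Real.abs_cos_le_one _)).trans (hCk _)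
  have hψd : ∀ ε, 0 < ε → ε ≤ 1 → ∀ x j,
      |fderiv ℝ (modulatedCutoff k ξ θ ε) x (e j)| ≤ Cd + Ck * (2 * Real.pi * |ξ j|) :=
    fun ε hε hε1 x j => by
      rw [fderiv_modulatedCutoff hk, hein]
      refine (abs_sub _ _).trans (add_le_add ?_ ?_)
      · rw [abs_mul, abs_mul, abs_of_pos hε]
        have h1 : |fderiv ℝ k (ε • x) (e j)| ≤ Cd := by
          have := (fderiv ℝ k (ε • x)).le_opNorm (e j)
          rw [hen, mul_one] at this
          exact this.trans (hCd _)
        have h2 : ε * |fderiv ℝ k (ε • x) (e j)| ≤ 1 * Cd :=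
          mul_le_mul hε1 h1 (abs_nonneg _) zero_le_one
        rw [one_mul] at h2
        exact (mul_le_of_le_one_right (by positivity) (Real.abs_cos_le_one _)).trans h2
      · rw [abs_mul]
        refine mul_le_mul (hCk _) ?_ (abs_nonneg _) hCk0
        rw [abs_mul, abs_mul, abs_of_pos Real.two_pi_pos]
        exact mul_le_of_le_one_right (by positivity) (Real.abs_sin_le_one _)
  set F : ℝ → ℝ × EuclideanSpace ℝ (Fin d) → ℝ := fun ε p =>
    w₀ p * (deriv χ p.1 * modulatedCutoff k ξ θ ε p.2) -
      w₁ p * (χ p.1 * psiLaplacian Ψ (modulatedCutoff k ξ θ ε) p.2) +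
      ∑ j, v j p * (χ p.1 * fderiv ℝ (modulatedCutoff k ξ θ ε) p.2 (e j)) with hF
  have hzero : ∀ ε, 0 < ε → ∫ p, F ε p ∂(spaceTimeMeasure d T) = 0 := fun ε hε =>
    h χ _ hχ hχs hχT (contDiff_modulatedCutoff hk ξ θ ε)
      (hasCompactSupport_modulatedCutoff hks ξ θ hε.ne')
  have hlim := tendsto_integral_filter_of_dominated_convergence (μ := spaceTimeMeasure d T)
    (l := 𝓝[>] (0 : ℝ)) (F := F) (f := fun p =>
      (w₀ p * deriv χ p.1 - w₁ p * (χ p.1 * Ψ ((2 * Real.pi * ‖ξ‖) ^ 2))) *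
        Real.cos (2 * Real.pi * inner ℝ p.2 ξ + θ) -
      (∑ j, v j p * (χ p.1 * (2 * Real.pi * ξ j))) *
        Real.sin (2 * Real.pi * inner ℝ p.2 ξ + θ))
    (fun p => |w₀ p| * (Cχ' * Ck) + |w₁ p| * (Cχ * B) +
      ∑ j, |v j p| * (Cχ * (Cd + Ck * (2 * Real.pi * |ξ j|)))) ?_ ?_ ?_ ?_
  · refine tendsto_nhds_unique hlim ?_
    refine tendsto_const_nhds.congr' ?_
    filter_upwards [self_mem_nhdsWithin] with ε hε using (hzero ε hε).symm
  · filter_upwards [self_mem_nhdsWithin] with ε hε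
    have c1 := (contDiff_modulatedCutoff hk ξ θ ε)
    have c2 := hasCompactSupport_modulatedCutoff hks ξ θ (ne_of_gt hε)
    have c3 := continuous_psiLaplacian hΨ hμ c1 c2
    have c4 : Continuous (fderiv ℝ (modulatedCutoff k ξ θ ε)) := c1.continuous_fderiv (by simp)
    have hχc := hχ.continuous
    have hψc := c1.continuous
    refine ((hw₀.1.mul ?_).sub (hw₁.1.mul ?_)).add
      (Finset.aestronglyMeasurable_fun_sum _ fun j _ => (hv j).1.mul ?_) <;>
    exact Continuous.aestronglyMeasurable (by fun_prop)
  · filter_upwards [Ioc_mem_nhdsGT one_pos] with ε hε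
    refine ae_of_all _ fun p => ?_
    refine (norm_add_le _ _).trans (add_le_add ((norm_sub_le _ _).trans (add_le_add ?_ ?_)) ?_)
    · rw [norm_mul, norm_mul]
      exact mul_le_mul_of_nonneg_left (mul_le_mul (hCχ' _) (hψb ε _) (norm_nonneg _)
        ((norm_nonneg _).trans (hCχ' 0))) (norm_nonneg _)
    · rw [norm_mul, norm_mul]
      exact mul_le_mul_of_nonneg_left (mul_le_mul (hCχ _) (hB ε hε.1 hε.2 _) (norm_nonneg _)
        hCχ0) (norm_nonneg _)
    · refine (norm_sum_le _ _).trans (Finset.sum_le_sum fun j _ => ?_)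
      rw [norm_mul, norm_mul]
      exact mul_le_mul_of_nonneg_left (mul_le_mul (hCχ _) (hψd ε hε.1 hε.2 _ j) (norm_nonneg _)
        hCχ0) (norm_nonneg _)
  · exact ((hw₀.abs.mul_const _).add (hw₁.abs.mul_const _)).add
      (integrable_finsetSum _ fun j _ => (hv j).abs.mul_const _)
  · refine ae_of_all _ fun p => ?_
    have hkt : Tendsto (fun ε : ℝ => k (ε • p.2)) (𝓝[>] 0) (𝓝 1) := by
      rw [← hk0]
      have : Continuous fun ε : ℝ => k (ε • p.2) := hk.continuous.comp (by fun_prop)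
      simpa using (this.tendsto 0).mono_left nhdsWithin_le_nhds
    have hψt : Tendsto (fun ε => modulatedCutoff k ξ θ ε p.2) (𝓝[>] 0)
        (𝓝 (Real.cos (2 * Real.pi * inner ℝ p.2 ξ + θ))) := by
      simpa [modulatedCutoff] using hkt.mul_const (Real.cos (2 * Real.pi * inner ℝ p.2 ξ + θ))
    have hpt := tendsto_psiLaplacian_modulatedCutoff hΨ hμ hk hks hk0 ξ θ p.2
    have hdt : ∀ j, Tendsto (fun ε => fderiv ℝ (modulatedCutoff k ξ θ ε) p.2 (e j)) (𝓝[>] 0)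
        (𝓝 (-(2 * Real.pi * ξ j * Real.sin (2 * Real.pi * inner ℝ p.2 ξ + θ)))) := fun j => by
      simp only [fderiv_modulatedCutoff hk, hein]
      have t1 : Tendsto (fun ε : ℝ => ε * fderiv ℝ k (ε • p.2) (e j)) (𝓝[>] 0) (𝓝 0) := by
        have : Continuous fun ε : ℝ => ε * fderiv ℝ k (ε • p.2) (e j) := by fun_prop
        simpa using (this.tendsto 0).mono_left nhdsWithin_le_nhds
      have := (t1.mul_const (Real.cos (2 * Real.pi * inner ℝ p.2 ξ + θ))).sub
        (hkt.mul_const (2 * Real.pi * ξ j * Real.sin (2 * Real.pi * inner ℝ p.2 ξ + θ)))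
      simpa using this
    have := (((hψt.const_mul (deriv χ p.1)).const_mul (w₀ p)).sub
      ((hpt.const_mul (χ p.1)).const_mul (w₁ p))).add
      (tendsto_finsetSum Finset.univ fun j _ => ((hdt j).const_mul (χ p.1)).const_mul (v j p))
    convert this using 2
    rw [sub_mul, Finset.sum_mul, sub_eq_add_neg _ (∑ j, _), ← Finset.sum_neg_distrib]
    congr 1
    · ring
    · exact Finset.sum_congr rfl fun j _ => by ring

/-- The spatial inverse Fourier transform of `w(t, ·)`. -/
noncomputable def spaceFourierInv {d : ℕ} (w : ℝ × EuclideanSpace ℝ (Fin d) → ℝ) (t : ℝ)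
    (ξ : EuclideanSpace ℝ (Fin d)) : ℂ :=
  𝓕⁻ (fun x => (w (t, x) : ℂ)) ξ

theorem spaceTimeMeasure_eq_prod (d : ℕ) (T : ℝ) :
    spaceTimeMeasure d T = (volume.restrict (Ioo 0 T)).prod volume := by
  rw [spaceTimeMeasure, Measure.volume_eq_prod, ← Measure.prod_restrict, Measure.restrict_univ]

theorem integrable_mul_planeWave {w : ℝ × EuclideanSpace ℝ (Fin d) → ℝ}
    (hw : Integrable w (spaceTimeMeasure d T)) (ξ : EuclideanSpace ℝ (Fin d)) :
    Integrable (fun p : ℝ × EuclideanSpace ℝ (Fin d) => planeWave ξ p.2 * (w p : ℂ))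
      (spaceTimeMeasure d T) := by
  refine hw.ofReal.bdd_mul (c := 1) (Continuous.aestronglyMeasurable ?_)
    (ae_of_all _ fun p => (norm_planeWave _ _).le)
  exact continuous_planeWave.comp (by fun_prop : Continuous
    fun p : ℝ × EuclideanSpace ℝ (Fin d) => (ξ, p.2))

theorem integrable_spaceFourierInv {w : ℝ × EuclideanSpace ℝ (Fin d) → ℝ}
    (hw : Integrable w (spaceTimeMeasure d T)) (ξ : EuclideanSpace ℝ (Fin d)) :
    IntegrableOn (fun t => spaceFourierInv w t ξ) (Ioo 0 T) := by
  have h := integrable_mul_planeWave hw ξ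
  rw [spaceTimeMeasure_eq_prod] at h
  simpa only [spaceFourierInv, fourierInv_eq_integral_planeWave, IntegrableOn]
    using h.integral_prod_left

theorem integral_mul_planeWave {w : ℝ × EuclideanSpace ℝ (Fin d) → ℝ}
    (hw : Integrable w (spaceTimeMeasure d T)) {c : ℝ → ℂ} (hc : Continuous c) {C : ℝ}
    (hC : ∀ t, ‖c t‖ ≤ C) (ξ : EuclideanSpace ℝ (Fin d)) :
    Integrable (fun p : ℝ × EuclideanSpace ℝ (Fin d) => c p.1 * (planeWave ξ p.2 * (w p : ℂ)))
      (spaceTimeMeasure d T) ∧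
    ∫ p, c p.1 * (planeWave ξ p.2 * (w p : ℂ)) ∂(spaceTimeMeasure d T) =
      ∫ t in Ioo 0 T, c t * spaceFourierInv w t ξ := by
  have h : Integrable
      (fun p : ℝ × EuclideanSpace ℝ (Fin d) => c p.1 * (planeWave ξ p.2 * (w p : ℂ)))
      (spaceTimeMeasure d T) :=
    (integrable_mul_planeWave hw ξ).bdd_mul (c := C)
      (hc.comp continuous_fst).aestronglyMeasurable (ae_of_all _ fun p => hC _)
  refine ⟨h, ?_⟩
  rw [spaceTimeMeasure_eq_prod] at h ⊢
  rw [integral_prod _ h]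
  refine integral_congr_ae (ae_of_all _ fun t => ?_)
  simp only [spaceFourierInv, fourierInv_eq_integral_planeWave, integral_const_mul]

/-- The time derivative of the Fourier mode `ξ` of a solution. -/
noncomputable def modeRate {d : ℕ} (Ψ : ℝ → ℝ) (w₁ : ℝ × EuclideanSpace ℝ (Fin d) → ℝ)
    (v : Fin d → ℝ × EuclideanSpace ℝ (Fin d) → ℝ) (t : ℝ) (ξ : EuclideanSpace ℝ (Fin d)) : ℂ :=
  -((Ψ ((2 * Real.pi * ‖ξ‖) ^ 2) : ℂ) * spaceFourierInv w₁ t ξ) +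
    ∑ j, ((2 * Real.pi * ξ j : ℝ) : ℂ) * Complex.I * spaceFourierInv (v j) t ξ

theorem integrableOn_modeRate (hw₁ : Integrable w₁ (spaceTimeMeasure d T))
    (hv : ∀ j, Integrable (v j) (spaceTimeMeasure d T)) (ξ : EuclideanSpace ℝ (Fin d)) :
    IntegrableOn (fun t => modeRate Ψ w₁ v t ξ) (Ioo 0 T) :=
  ((integrable_spaceFourierInv hw₁ ξ).const_mul _).neg.add
    (integrable_finsetSum _ fun j _ => (integrable_spaceFourierInv (hv j) ξ).const_mul _)

/-- Testing with a full plane wave gives the weak form of a scalar equation in time, to which the du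
Bois-Reymond lemma applies. The null set of times may depend on ξ. -/
theorem IsTensorSolution.spaceFourierInv_eq_primitive (h : IsTensorSolution T Ψ w₀ w₁ v)
    (hT : 0 < T) (hΨ : IsBernsteinFunction Ψ) (hμ : HasLevyKhintchineRepr Ψ 0 0 μ)
    (hw₀ : Integrable w₀ (spaceTimeMeasure d T)) (hw₁ : Integrable w₁ (spaceTimeMeasure d T))
    (hv : ∀ j, Integrable (v j) (spaceTimeMeasure d T)) (ξ : EuclideanSpace ℝ (Fin d)) :
    ∀ᵐ t ∂(volume.restrict (Ioo 0 T)),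
      spaceFourierInv w₀ t ξ = ∫ s in Ioo 0 t, modeRate Ψ w₁ v s ξ := by
  refine ae_eq_primitive_of_weak hT (integrable_spaceFourierInv hw₀ ξ)
    (integrableOn_modeRate hw₁ hv ξ) fun χ hχ hχs hχT => ?_
  obtain ⟨Cχ, hCχ⟩ := hχs.exists_bound_of_continuous hχ.continuous
  have hχ' : Continuous (deriv χ) := hχ.continuous_deriv (by simp)
  obtain ⟨Cχ', hCχ'⟩ := hχs.deriv.exists_bound_of_continuous hχ'
  have hχc : Continuous fun t => (χ t : ℂ) := Complex.continuous_ofReal.comp hχ.continuous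
  have hχc' : Continuous fun t => ((deriv χ t : ℝ) : ℂ) := Complex.continuous_ofReal.comp hχ'
  have hCχc : ∀ t, ‖(χ t : ℂ)‖ ≤ Cχ := fun t => by simpa using hCχ t
  have hCχc' : ∀ t, ‖((deriv χ t : ℝ) : ℂ)‖ ≤ Cχ' := fun t => by
    simpa only [Complex.norm_real] using hCχ' t
  obtain ⟨i0, e0⟩ := integral_mul_planeWave hw₀ hχc' hCχc' ξ
  obtain ⟨i1, e1⟩ := integral_mul_planeWave hw₁ hχc hCχc ξ
  have hvj := fun j => integral_mul_planeWave (hv j) hχc hCχc ξ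
  have hc := h.integral_mul_cos_sub_mul_sin hΨ hμ hw₀ hw₁ hv hχ hχs hχT ξ 0
  -- The phase -π/2 replaces cos by sin and sin by -cos; phases 0 and -π/2 yield the real and
  -- imaginary parts.
  have hs := h.integral_mul_cos_sub_mul_sin hΨ hμ hw₀ hw₁ hv hχ hχs hχT ξ (-(Real.pi / 2))
  set P : ℂ := (Ψ ((2 * Real.pi * ‖ξ‖) ^ 2) : ℂ) with hP
  set G : ℝ × EuclideanSpace ℝ (Fin d) → ℂ := fun p =>
    ((deriv χ p.1 : ℝ) : ℂ) * (planeWave ξ p.2 * (w₀ p : ℂ)) -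
      P * ((χ p.1 : ℂ) * (planeWave ξ p.2 * (w₁ p : ℂ))) +
      ∑ j, ((2 * Real.pi * ξ j : ℝ) : ℂ) * Complex.I *
        ((χ p.1 : ℂ) * (planeWave ξ p.2 * (v j p : ℂ))) with hG
  have hGi : Integrable G (spaceTimeMeasure d T) :=
    (i0.sub (i1.const_mul _)).add (integrable_finsetSum _ fun j _ => (hvj j).1.const_mul _)
  have hG0 : ∫ p, G p ∂(spaceTimeMeasure d T) = 0 := by
    have hcos : ∀ x : EuclideanSpace ℝ (Fin d), planeWave ξ x =
        (Real.cos (2 * Real.pi * inner ℝ x ξ) : ℂ) +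
          (Real.sin (2 * Real.pi * inner ℝ x ξ) : ℂ) * Complex.I := fun x => by
      rw [planeWave_eq_exp, Complex.exp_mul_I, Complex.ofReal_cos, Complex.ofReal_sin]
    refine Complex.ext ?_ ?_
    · rw [Complex.zero_re, ← hc]
      refine (Complex.reCLM.integral_comp_comm hGi).symm.trans
        (integral_congr_ae (ae_of_all _ fun p => ?_))
      simp only [hG, hcos, hP, Complex.reCLM_apply, Complex.add_re, Complex.sub_re,
        Complex.re_sum, add_zero]
      rw [Finset.sum_mul, sub_eq_add_neg _ (∑ j, _), ← Finset.sum_neg_distrib]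
      generalize Real.cos (2 * Real.pi * inner ℝ p.2 ξ) = c
      generalize Real.sin (2 * Real.pi * inner ℝ p.2 ξ) = s
      congr 1
      · simp
        ring
      · refine Finset.sum_congr rfl fun j _ => ?_
        simp
        ring
    · rw [Complex.zero_im, ← hs]
      refine (Complex.imCLM.integral_comp_comm hGi).symm.trans
        (integral_congr_ae (ae_of_all _ fun p => ?_))
      simp only [hG, hcos, hP, Complex.imCLM_apply, Complex.add_im, Complex.sub_im,
        Complex.im_sum, ← sub_eq_add_neg, Real.cos_sub_pi_div_two, Real.sin_sub_pi_div_two]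
      rw [Finset.sum_mul, sub_eq_add_neg _ (∑ j, _), ← Finset.sum_neg_distrib]
      generalize Real.cos (2 * Real.pi * inner ℝ p.2 ξ) = c
      generalize Real.sin (2 * Real.pi * inner ℝ p.2 ξ) = s
      congr 1
      · simp
        ring
      · refine Finset.sum_congr rfl fun j _ => ?_
        simp
        ring
  have i01 : Integrable (fun p : ℝ × EuclideanSpace ℝ (Fin d) =>
      ((deriv χ p.1 : ℝ) : ℂ) * (planeWave ξ p.2 * (w₀ p : ℂ)) -
        P * ((χ p.1 : ℂ) * (planeWave ξ p.2 * (w₁ p : ℂ)))) (spaceTimeMeasure d T) :=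
    i0.sub (i1.const_mul _)
  have hsum : ∫ p, G p ∂(spaceTimeMeasure d T) =
      (∫ t in Ioo 0 T, ((deriv χ t : ℝ) : ℂ) * spaceFourierInv w₀ t ξ) -
        P * (∫ t in Ioo 0 T, (χ t : ℂ) * spaceFourierInv w₁ t ξ) +
      ∑ j, ((2 * Real.pi * ξ j : ℝ) : ℂ) * Complex.I *
        ∫ t in Ioo 0 T, (χ t : ℂ) * spaceFourierInv (v j) t ξ := by
    simp only [hG]
    rw [integral_add i01
      (integrable_finsetSum _ fun j _ => (hvj j).1.const_mul _),
      integral_finsetSum _ fun j _ => (hvj j).1.const_mul _]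
    congr 1
    · rw [← e0, ← e1, ← integral_const_mul]
      exact integral_sub i0 (i1.const_mul _)
    · exact Finset.sum_congr rfl fun j _ => by rw [integral_const_mul, (hvj j).2]
  have hmul : ∀ {c : ℝ → ℂ} {C : ℝ}, Continuous c → (∀ t, ‖c t‖ ≤ C) →
      ∀ {w : ℝ × EuclideanSpace ℝ (Fin d) → ℝ}, Integrable w (spaceTimeMeasure d T) →
      IntegrableOn (fun t => c t * spaceFourierInv w t ξ) (Ioo 0 T) := fun hc hC w hw =>
    (integrable_spaceFourierInv hw ξ).bdd_mul hc.aestronglyMeasurable (ae_of_all _ hC)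
  rw [hG0] at hsum
  rw [hsum]
  have j0 := hmul hχc' hCχc' hw₀
  have j1 := (hmul hχc hCχc hw₁).const_mul P
  have j01 : Integrable (fun t => ((deriv χ t : ℝ) : ℂ) * spaceFourierInv w₀ t ξ -
      P * ((χ t : ℂ) * spaceFourierInv w₁ t ξ)) (volume.restrict (Ioo 0 T)) := j0.sub j1
  have jv := fun j => (hmul hχc hCχc (hv j)).const_mul (((2 * Real.pi * ξ j : ℝ) : ℂ) * Complex.I)
  rw [← integral_const_mul, ← integral_sub j0 j1]
  simp only [← integral_const_mul]
  rw [← integral_finsetSum _ fun j _ => jv j, ← integral_add j01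
    (integrable_finsetSum _ fun j _ => jv j)]
  refine integral_congr_ae (ae_of_all _ fun t => ?_)
  simp only [modeRate, mul_add, Finset.mul_sum]
  rw [← add_assoc]
  congr 1
  · ring
  · exact Finset.sum_congr rfl fun j _ => by ring

end TensorSolution

/-! ### Where s > 1/2 enters. -/

section Growth

/-- Since 2s > 1, (1+Ψ(r))² ≥ C² r^{2s} exceeds r/η beyond some threshold; below it, r is bounded by
a constant. The freedom in η is what later makes the drift absorbable. -/
theorem exists_le_sq_add_of_rpow_le {Ψ : ℝ → ℝ} {s C : ℝ} (hs : 1 / 2 < s) (hC : 0 < C)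
    (hΨ : ∀ r, 0 ≤ r → 0 ≤ Ψ r) (hΨC : ∀ r : ℝ, 0 ≤ r → C * r ^ s ≤ Ψ r) {η : ℝ} (hη : 0 < η) :
    ∃ K : ℝ, 0 ≤ K ∧ ∀ r, 0 ≤ r → r ≤ η * (1 + Ψ r) ^ 2 + K * (1 + Ψ r) := by
  have hlim := (tendsto_rpow_atTop (show 0 < 2 * s - 1 by linarith)).eventually_ge_atTop
    (1 / (η * C ^ 2))
  obtain ⟨R, hR⟩ := eventually_atTop.1 hlim
  refine ⟨|R|, abs_nonneg _, fun r hr => ?_⟩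
  have h0 := hΨ r hr
  rcases le_total R r with h | h
  · rcases hr.eq_or_lt with rfl | hr0
    · positivity
    have h1 : 1 ≤ r ^ (2 * s - 1) * (η * C ^ 2) := (div_le_iff₀ (by positivity)).1 (hR r h)
    have h2 : r * r ^ (2 * s - 1) = (r ^ s) ^ 2 := by
      rw [← Real.rpow_one_add' hr (by linarith), ← Real.rpow_mul_natCast hr]
      congr 1
      push_cast
      ring
    have h3 : r ≤ η * (C * r ^ s) ^ 2 := by
      calc r = r * 1 := (mul_one r).symm
        _ ≤ r * (r ^ (2 * s - 1) * (η * C ^ 2)) := mul_le_mul_of_nonneg_left h1 hr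
        _ = η * (C * r ^ s) ^ 2 := by rw [← mul_assoc, h2]; ring
    have h4 : (C * r ^ s) ^ 2 ≤ (1 + Ψ r) ^ 2 :=
      pow_le_pow_left₀ (by positivity) ((hΨC r hr).trans (by linarith)) 2
    have h5 : 0 ≤ |R| * (1 + Ψ r) := by positivity
    nlinarith [mul_le_mul_of_nonneg_left h4 hη.le]
  · have h1 : r ≤ |R| := h.trans (le_abs_self R)
    have h2 : 0 ≤ η * (1 + Ψ r) ^ 2 := by positivity
    nlinarith [abs_nonneg R]

end Growth

/-! ### Grönwall's inequality. -/

section Gronwall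

/-- A Grönwall inequality for functions known almost everywhere. -/
theorem ae_eq_zero_of_eq_primitive_of_le {γ h : ℝ → ℝ} {T K : ℝ} (hK : 0 ≤ K)
    (hγ : IntegrableOn γ (Ioo 0 T))
    (hprim : ∀ᵐ t ∂(volume.restrict (Ioo 0 T)), h t = ∫ s in Ioo 0 t, γ s)
    (hnonneg : ∀ t, 0 ≤ h t)
    (hle : ∀ᵐ t ∂(volume.restrict (Ioo 0 T)), γ t ≤ K * h t) :
    ∀ᵐ t ∂(volume.restrict (Ioo 0 T)), h t = 0 := by
  set γ' : ℝ → ℝ := (Ioo 0 T).indicator γ with hγ'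
  have hγi : Integrable γ' := (integrable_indicator_iff measurableSet_Ioo).2 hγ
  set H : ℝ → ℝ := fun t => ∫ s in (0 : ℝ)..t, γ' s with hH
  have hHc : Continuous H := intervalIntegral.continuous_primitive
    (fun a b => hγi.intervalIntegrable) 0
  have hHeq : ∀ t ∈ Ioo 0 T, H t = ∫ s in Ioo 0 t, γ s := fun t ht => by
    rw [hH]
    simp only
    rw [intervalIntegral.integral_of_le ht.1.le, integral_Ioc_eq_integral_Ioo]
    refine setIntegral_congr_fun measurableSet_Ioo fun s hs => ?_
    exact indicator_of_mem (show s ∈ Ioo 0 T from ⟨hs.1, hs.2.trans ht.2⟩) γ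
  have hhH : ∀ᵐ t ∂(volume.restrict (Ioo 0 T)), h t = H t := by
    filter_upwards [hprim, ae_restrict_mem measurableSet_Ioo] with t ht htT
    rw [ht, hHeq t htT]
  -- H is only a primitive of an integrable function. Its own primitive Φ is differentiable
  -- everywhere with Φ' = H ≤ KΦ, so the integrating factor e^{-Kt} is applied to Φ.
  set Φ : ℝ → ℝ := fun t => ∫ s in (0 : ℝ)..t, H s with hΦ
  have hΦd : ∀ t, HasDerivAt Φ (H t) t := fun t =>
    intervalIntegral.integral_hasDerivAt_right (hHc.intervalIntegrable _ _)
      (hHc.stronglyMeasurableAtFilter _ _) hHc.continuousAt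
  have hHΦ : ∀ t ∈ Ioo 0 T, H t ≤ K * Φ t := fun t ht => by
    rw [hΦ]
    simp only
    rw [← intervalIntegral.integral_const_mul, hH]
    simp only
    refine intervalIntegral.integral_mono_ae_restrict ht.1.le hγi.intervalIntegrable
      ((hHc.const_mul K).intervalIntegrable _ _) ?_
    have hsub : ∀ᵐ s ∂(volume.restrict (Ioo 0 t)), γ' s ≤ K * H s := by
      have h1 : ∀ᵐ s ∂(volume.restrict (Ioo 0 T)), γ' s ≤ K * H s := by
        filter_upwards [hhH, hle, ae_restrict_mem measurableSet_Ioo] with s h1 h2 h3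
        rw [hγ', indicator_of_mem h3, ← h1]
        exact h2
      exact ae_restrict_of_ae_restrict_of_subset (Ioo_subset_Ioo_right ht.2.le) h1
    rwa [← Measure.restrict_congr_set (Ioo_ae_eq_Icc (a := (0 : ℝ)) (b := t))]
  have hanti : AntitoneOn (fun t => Φ t * Real.exp (-(K * t))) (Icc 0 T) := by
    have hd : ∀ t, HasDerivAt (fun t => Φ t * Real.exp (-(K * t)))
        (H t * Real.exp (-(K * t)) + Φ t * (Real.exp (-(K * t)) * (-(K * 1)))) t := fun t =>
      (hΦd t).fun_mul (((hasDerivAt_id t).const_mul K).fun_neg.exp)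
    refine antitoneOn_of_deriv_nonpos (convex_Icc 0 T)
      (fun t _ => (hd t).continuousAt.continuousWithinAt)
      (fun t _ => (hd t).differentiableAt.differentiableWithinAt) fun t ht => ?_
    rw [interior_Icc] at ht
    rw [(hd t).deriv]
    nlinarith [hHΦ t ht, Real.exp_pos (-(K * t))]
  filter_upwards [hhH, ae_restrict_mem measurableSet_Ioo] with t ht htT
  refine le_antisymm ?_ (hnonneg t)
  have h1 := hanti (left_mem_Icc.2 (htT.1.trans htT.2).le) (Ioo_subset_Icc_self htT) htT.1.le
  have h2 : Φ 0 = 0 := by simp [hΦ]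
  simp only [h2, zero_mul] at h1
  have h3 : Φ t ≤ 0 := by
    by_contra hpos
    exact absurd h1 (not_le.2 (mul_pos (not_le.1 hpos) (Real.exp_pos _)))
  rw [ht]
  exact (hHΦ t htT).trans (mul_nonpos_of_nonneg_of_nonpos hK h3)

end Gronwall

/-! ### The energy inequality at a fixed time. -/

section EnergyRate

theorem two_mul_re_conj_mul_le {δ : ℝ} (hδ : 0 < δ) (z w : ℂ) :
    2 * (starRingEnd ℂ z * w).re ≤ δ * ‖w‖ ^ 2 + δ⁻¹ * ‖z‖ ^ 2 := by
  have h1 : (starRingEnd ℂ z * w).re ≤ ‖z‖ * ‖w‖ := by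
    refine (Complex.re_le_norm _).trans ?_
    rw [norm_mul, RCLike.norm_conj]
  have h2 : 0 ≤ δ⁻¹ * (δ * ‖w‖ - ‖z‖) ^ 2 := by positivity
  have h3 : δ⁻¹ * (δ * ‖w‖ - ‖z‖) ^ 2 = δ * ‖w‖ ^ 2 + δ⁻¹ * ‖z‖ ^ 2 - 2 * (‖z‖ * ‖w‖) := by
    field_simp
    ring
  linarith

variable {d : ℕ} {Ψ : ℝ → ℝ}

theorem sq_two_pi_mul_coord_le (ξ : EuclideanSpace ℝ (Fin d)) (j : Fin d) :
    (2 * Real.pi * ξ j) ^ 2 ≤ (2 * Real.pi * ‖ξ‖) ^ 2 := by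
  have h : ‖ξ j‖ ≤ ‖ξ‖ := PiLp.norm_apply_le ξ j
  rw [mul_pow, mul_pow (2 * Real.pi) ‖ξ‖]
  refine mul_le_mul_of_nonneg_left ?_ (by positivity)
  rw [← sq_abs (ξ j)]
  exact pow_le_pow_left₀ (abs_nonneg _) h 2

/-- Absorption of a first order term. -/
theorem two_mul_re_conj_mul_coord_div_le {δ η K : ℝ} (hδ : 0 < δ)
    (hΨ : ∀ r, 0 ≤ r → 0 ≤ Ψ r)
    (hK : ∀ r, 0 ≤ r → r ≤ η * (1 + Ψ r) ^ 2 + K * (1 + Ψ r))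
    (ξ : EuclideanSpace ℝ (Fin d)) (j : Fin d) (z w : ℂ) :
    2 * (starRingEnd ℂ z * (((2 * Real.pi * ξ j : ℝ) : ℂ) * Complex.I * w)).re *
        (1 + Ψ ((2 * Real.pi * ‖ξ‖) ^ 2))⁻¹ ≤
      δ * ‖w‖ ^ 2 + (δ⁻¹ * η + δ⁻¹ * K * (1 + Ψ ((2 * Real.pi * ‖ξ‖) ^ 2))⁻¹) * ‖z‖ ^ 2 := by
  set r := (2 * Real.pi * ‖ξ‖) ^ 2 with hr
  have hr0 : 0 ≤ r := by positivity
  have hp : 0 < 1 + Ψ r := by linarith [hΨ r hr0]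
  set q := (1 + Ψ r)⁻¹ with hq
  have hqp : 0 < q := inv_pos.2 hp
  set x : ℝ := 2 * Real.pi * ξ j with hx
  -- The whole factor x q is attached to z, so that Young's inequality produces x²q², which the
  -- growth hypothesis bounds by η + Kq.
  have h1 := two_mul_re_conj_mul_le hδ (((x * q : ℝ) : ℂ) * z) (Complex.I * w)
  have h2 : (starRingEnd ℂ (((x * q : ℝ) : ℂ) * z) * (Complex.I * w)).re =
      (starRingEnd ℂ z * ((x : ℂ) * Complex.I * w)).re * q := by
    have : starRingEnd ℂ (((x * q : ℝ) : ℂ) * z) * (Complex.I * w) =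
        ((q : ℝ) : ℂ) * (starRingEnd ℂ z * ((x : ℂ) * Complex.I * w)) := by
      rw [map_mul, Complex.conj_ofReal]
      push_cast
      ring
    rw [this, Complex.re_ofReal_mul, mul_comm]
  rw [h2, ← mul_assoc] at h1
  refine h1.trans ?_
  rw [norm_mul, norm_mul, Complex.norm_I, one_mul, Complex.norm_real, mul_pow, Real.norm_eq_abs,
    sq_abs, mul_pow]
  have h3 : x ^ 2 * q ^ 2 ≤ η + K * q := by
    have h4 : x ^ 2 * q ^ 2 ≤ (η * (1 + Ψ r) ^ 2 + K * (1 + Ψ r)) * q ^ 2 :=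
      mul_le_mul_of_nonneg_right ((sq_two_pi_mul_coord_le ξ j).trans (hK r hr0)) (by positivity)
    have h5 : (η * (1 + Ψ r) ^ 2 + K * (1 + Ψ r)) * q ^ 2 = η + K * q := by
      rw [hq]; field_simp
    linarith
  have h6 : δ⁻¹ * (x ^ 2 * q ^ 2 * ‖z‖ ^ 2) ≤ δ⁻¹ * ((η + K * q) * ‖z‖ ^ 2) :=
    mul_le_mul_of_nonneg_left (mul_le_mul_of_nonneg_right h3 (by positivity)) (by positivity)
  linarith [h6, show δ⁻¹ * ((η + K * q) * ‖z‖ ^ 2) = (δ⁻¹ * η + δ⁻¹ * K * q) * ‖z‖ ^ 2 by ring]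

/-- The energy dissipation inequality at a fixed time. -/
theorem integral_two_mul_re_conj_mul_rate_le (hΨ : ∀ r, 0 ≤ r → 0 ≤ Ψ r)
    (hΨc : Continuous fun ξ : EuclideanSpace ℝ (Fin d) => Ψ ((2 * Real.pi * ‖ξ‖) ^ 2))
    {f₀ f₁ : EuclideanSpace ℝ (Fin d) → ℝ} {g : Fin d → EuclideanSpace ℝ (Fin d) → ℝ}
    (hf₀ : Integrable f₀) (hf₀2 : MemLp f₀ 2) (hf₁ : Integrable f₁) (hf₁2 : MemLp f₁ 2)
    (hg : ∀ j, Integrable (g j)) (hg2 : ∀ j, MemLp (g j) 2) {A Q a b c : ℝ} (hA : 0 < A)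
    (ha : 0 ≤ a) (hf₁A : ∀ᵐ x, f₁ x ^ 2 ≤ A * (f₀ x * f₁ x))
    (hgQ : ∀ j, ∀ᵐ x, g j x ^ 2 ≤ Q * f₀ x ^ 2)
    (hab : ∀ᵐ x, d * (a * Q + b) * f₀ x ^ 2 ≤ f₀ x * f₁ x)
    (hbd : ∀ ξ j, 2 * (starRingEnd ℂ (𝓕⁻ (fun x => (f₀ x : ℂ)) ξ) *
        (((2 * Real.pi * ξ j : ℝ) : ℂ) * Complex.I * 𝓕⁻ (fun x => (g j x : ℂ)) ξ)).re *
        (1 + Ψ ((2 * Real.pi * ‖ξ‖) ^ 2))⁻¹ ≤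
      a * ‖𝓕⁻ (fun x => (g j x : ℂ)) ξ‖ ^ 2 +
        (b + c * (1 + Ψ ((2 * Real.pi * ‖ξ‖) ^ 2))⁻¹) * ‖𝓕⁻ (fun x => (f₀ x : ℂ)) ξ‖ ^ 2)
    (hint : Integrable fun ξ => 2 * (starRingEnd ℂ (𝓕⁻ (fun x => (f₀ x : ℂ)) ξ) *
        (-((Ψ ((2 * Real.pi * ‖ξ‖) ^ 2) : ℂ) * 𝓕⁻ (fun x => (f₁ x : ℂ)) ξ) +
          ∑ j, ((2 * Real.pi * ξ j : ℝ) : ℂ) * Complex.I * 𝓕⁻ (fun x => (g j x : ℂ)) ξ)).re *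
        (1 + Ψ ((2 * Real.pi * ‖ξ‖) ^ 2))⁻¹) :
    ∫ ξ, 2 * (starRingEnd ℂ (𝓕⁻ (fun x => (f₀ x : ℂ)) ξ) *
        (-((Ψ ((2 * Real.pi * ‖ξ‖) ^ 2) : ℂ) * 𝓕⁻ (fun x => (f₁ x : ℂ)) ξ) +
          ∑ j, ((2 * Real.pi * ξ j : ℝ) : ℂ) * Complex.I * 𝓕⁻ (fun x => (g j x : ℂ)) ξ)).re *
        (1 + Ψ ((2 * Real.pi * ‖ξ‖) ^ 2))⁻¹ ≤
      (A + d * c) * ∫ ξ, ‖𝓕⁻ (fun x => (f₀ x : ℂ)) ξ‖ ^ 2 *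
        (1 + Ψ ((2 * Real.pi * ‖ξ‖) ^ 2))⁻¹ := by
  set ζ : EuclideanSpace ℝ (Fin d) → ℂ := 𝓕⁻ (fun x => (f₀ x : ℂ)) with hζ
  set ρ : EuclideanSpace ℝ (Fin d) → ℂ := 𝓕⁻ (fun x => (f₁ x : ℂ)) with hρ
  set σ : Fin d → EuclideanSpace ℝ (Fin d) → ℂ := fun j => 𝓕⁻ (fun x => (g j x : ℂ)) with hσ
  set q : EuclideanSpace ℝ (Fin d) → ℝ := fun ξ => (1 + Ψ ((2 * Real.pi * ‖ξ‖) ^ 2))⁻¹ with hq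
  have hp : ∀ ξ : EuclideanSpace ℝ (Fin d), 0 < 1 + Ψ ((2 * Real.pi * ‖ξ‖) ^ 2) := fun ξ => by
    linarith [hΨ ((2 * Real.pi * ‖ξ‖) ^ 2) (by positivity)]
  have hq0 : ∀ ξ, 0 < q ξ := fun ξ => inv_pos.2 (hp ξ)
  have hq1 : ∀ ξ, q ξ ≤ 1 := fun ξ =>
    inv_le_one_of_one_le₀ (by linarith [hΨ ((2 * Real.pi * ‖ξ‖) ^ 2) (by positivity)])
  have hqc : Continuous q := (continuous_const.add hΨc).inv₀ fun ξ => (hp ξ).ne'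
  have cf₀ : Integrable fun x => (f₀ x : ℂ) := hf₀.ofReal
  have cf₀2 : MemLp (fun x => (f₀ x : ℂ)) 2 := hf₀2.ofReal
  have cf₁ : Integrable fun x => (f₁ x : ℂ) := hf₁.ofReal
  have cf₁2 : MemLp (fun x => (f₁ x : ℂ)) 2 := hf₁2.ofReal
  have cg : ∀ j, Integrable fun x => (g j x : ℂ) := fun j => (hg j).ofReal
  have cg2 : ∀ j, MemLp (fun x => (g j x : ℂ)) 2 := fun j => (hg2 j).ofReal
  have hζ2 : MemLp ζ 2 := memLp_two_fourierInv cf₀ cf₀2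
  have hρ2 : MemLp ρ 2 := memLp_two_fourierInv cf₁ cf₁2
  have hσ2 : ∀ j, MemLp (σ j) 2 := fun j => memLp_two_fourierInv (cg j) (cg2 j)
  have iζ : Integrable fun ξ => ‖ζ ξ‖ ^ 2 := hζ2.integrable_norm_pow two_ne_zero
  have iρ : Integrable fun ξ => ‖ρ ξ‖ ^ 2 := hρ2.integrable_norm_pow two_ne_zero
  have iσ : ∀ j, Integrable fun ξ => ‖σ j ξ‖ ^ 2 := fun j =>
    (hσ2 j).integrable_norm_pow two_ne_zero
  have iζρ : Integrable fun ξ => starRingEnd ℂ (ζ ξ) * ρ ξ := hζ2.star.integrable_mul hρ2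
  have iζq : Integrable fun ξ => ‖ζ ξ‖ ^ 2 * q ξ := by
    refine iζ.mul_bdd (c := 1) hqc.aestronglyMeasurable (ae_of_all _ fun ξ => ?_)
    rw [Real.norm_of_nonneg (hq0 ξ).le]
    exact hq1 ξ
  have pζ : ∫ ξ, ‖ζ ξ‖ ^ 2 = ∫ x, f₀ x ^ 2 := by
    rw [hζ, integral_norm_sq_fourierInv cf₀ cf₀2]
    simp
  have pρ : ∫ ξ, ‖ρ ξ‖ ^ 2 = ∫ x, f₁ x ^ 2 := by
    rw [hρ, integral_norm_sq_fourierInv cf₁ cf₁2]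
    simp
  have pσ : ∀ j, ∫ ξ, ‖σ j ξ‖ ^ 2 = ∫ x, g j x ^ 2 := fun j => by
    simp only [hσ]
    rw [integral_norm_sq_fourierInv (cg j) (cg2 j)]
    simp
  have pζρ : ∫ ξ, (starRingEnd ℂ (ζ ξ) * ρ ξ).re = ∫ x, f₀ x * f₁ x := by
    have h1 : ∫ ξ, (starRingEnd ℂ (ζ ξ) * ρ ξ).re = (∫ ξ, starRingEnd ℂ (ζ ξ) * ρ ξ).re :=
      Complex.reCLM.integral_comp_comm iζρ
    rw [h1, hζ, hρ, integral_conj_fourierInv_mul_fourierInv cf₀ cf₀2 cf₁ cf₁2]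
    simp only [Complex.conj_ofReal, ← Complex.ofReal_mul]
    rw [integral_complex_ofReal, Complex.ofReal_re]
  -- A pointwise majorant of the rate made only of integrable terms, each computable by Plancherel
  -- or a multiple of the energy density.
  set S : EuclideanSpace ℝ (Fin d) → ℝ := fun ξ =>
    -2 * (starRingEnd ℂ (ζ ξ) * ρ ξ).re + (A⁻¹ * ‖ρ ξ‖ ^ 2 + A * (‖ζ ξ‖ ^ 2 * q ξ)) +
      ∑ j, (a * ‖σ j ξ‖ ^ 2 + (b * ‖ζ ξ‖ ^ 2 + c * (‖ζ ξ‖ ^ 2 * q ξ))) with hS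
  have hle : ∀ ξ, 2 * (starRingEnd ℂ (ζ ξ) * (-((Ψ ((2 * Real.pi * ‖ξ‖) ^ 2) : ℂ) * ρ ξ) +
      ∑ j, ((2 * Real.pi * ξ j : ℝ) : ℂ) * Complex.I * σ j ξ)).re * q ξ ≤ S ξ := fun ξ => by
    have hsum : ∑ j, 2 * (starRingEnd ℂ (ζ ξ) *
        (((2 * Real.pi * ξ j : ℝ) : ℂ) * Complex.I * σ j ξ)).re * q ξ ≤
        ∑ j, (a * ‖σ j ξ‖ ^ 2 + (b * ‖ζ ξ‖ ^ 2 + c * (‖ζ ξ‖ ^ 2 * q ξ))) :=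
      Finset.sum_le_sum fun j _ => (hbd ξ j).trans (le_of_eq (by simp only [hq, hσ]; ring))
    -- This identity separates the diffusion into an unweighted term, which Plancherel evaluates as
    -- -2∫ f₀f₁, and a term with weight q, which Young's inequality splits.
    have hΨq : Ψ ((2 * Real.pi * ‖ξ‖) ^ 2) * q ξ = 1 - q ξ := by
      rw [eq_sub_iff_add_eq, ← add_one_mul, add_comm _ (1 : ℝ)]
      exact mul_inv_cancel₀ (hp ξ).ne'
    have h1 := two_mul_re_conj_mul_le (inv_pos.2 hA) (((q ξ : ℝ) : ℂ) * ζ ξ) (ρ ξ)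
    have h2 : (starRingEnd ℂ (((q ξ : ℝ) : ℂ) * ζ ξ) * ρ ξ).re =
        q ξ * (starRingEnd ℂ (ζ ξ) * ρ ξ).re := by
      rw [map_mul, Complex.conj_ofReal, mul_assoc, Complex.re_ofReal_mul]
    have h3 : ‖((q ξ : ℝ) : ℂ) * ζ ξ‖ ^ 2 ≤ ‖ζ ξ‖ ^ 2 * q ξ := by
      rw [norm_mul, mul_pow, Complex.norm_real, Real.norm_of_nonneg (hq0 ξ).le]
      nlinarith [mul_nonneg (sq_nonneg ‖ζ ξ‖) (mul_nonneg (hq0 ξ).le (sub_nonneg.2 (hq1 ξ)))]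
    rw [h2, inv_inv] at h1
    have h4 := mul_le_mul_of_nonneg_left h3 hA.le
    have hexp : 2 * (starRingEnd ℂ (ζ ξ) * (-((Ψ ((2 * Real.pi * ‖ξ‖) ^ 2) : ℂ) * ρ ξ) +
        ∑ j, ((2 * Real.pi * ξ j : ℝ) : ℂ) * Complex.I * σ j ξ)).re * q ξ =
        -2 * (Ψ ((2 * Real.pi * ‖ξ‖) ^ 2) * q ξ) * (starRingEnd ℂ (ζ ξ) * ρ ξ).re +
        ∑ j, 2 * (starRingEnd ℂ (ζ ξ) *
          (((2 * Real.pi * ξ j : ℝ) : ℂ) * Complex.I * σ j ξ)).re * q ξ := by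
      rw [mul_add, Finset.mul_sum, Complex.add_re, Complex.re_sum, mul_add, add_mul,
        Finset.mul_sum, Finset.sum_mul]
      congr 1
      have : starRingEnd ℂ (ζ ξ) * -((Ψ ((2 * Real.pi * ‖ξ‖) ^ 2) : ℂ) * ρ ξ) =
          ((-Ψ ((2 * Real.pi * ‖ξ‖) ^ 2) : ℝ) : ℂ) * (starRingEnd ℂ (ζ ξ) * ρ ξ) := by
        push_cast; ring
      rw [this, Complex.re_ofReal_mul]
      ring
    rw [hexp, hΨq, hS]
    simp only
    nlinarith [h1, h4, hsum]
  have iT : Integrable fun ξ => -2 * (starRingEnd ℂ (ζ ξ) * ρ ξ).re := iζρ.re.const_mul (-2)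
  have iU : Integrable fun ξ => A⁻¹ * ‖ρ ξ‖ ^ 2 + A * (‖ζ ξ‖ ^ 2 * q ξ) :=
    (iρ.const_mul _).add (iζq.const_mul _)
  have iTU : Integrable fun ξ => -2 * (starRingEnd ℂ (ζ ξ) * ρ ξ).re +
    (A⁻¹ * ‖ρ ξ‖ ^ 2 + A * (‖ζ ξ‖ ^ 2 * q ξ)) := iT.add iU
  have iB : Integrable fun ξ => b * ‖ζ ξ‖ ^ 2 + c * (‖ζ ξ‖ ^ 2 * q ξ) :=
    (iζ.const_mul _).add (iζq.const_mul _)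
  have iV : ∀ j, Integrable fun ξ =>
      a * ‖σ j ξ‖ ^ 2 + (b * ‖ζ ξ‖ ^ 2 + c * (‖ζ ξ‖ ^ 2 * q ξ)) := fun j =>
    ((iσ j).const_mul _).add iB
  have hSi : Integrable S := iTU.add (integrable_finsetSum _ fun j _ => iV j)
  have hSint : ∫ ξ, S ξ = -2 * (∫ x, f₀ x * f₁ x) + (A⁻¹ * (∫ x, f₁ x ^ 2) +
      A * ∫ ξ, ‖ζ ξ‖ ^ 2 * q ξ) + ∑ j, (a * (∫ x, g j x ^ 2) + (b * (∫ x, f₀ x ^ 2) +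
        c * ∫ ξ, ‖ζ ξ‖ ^ 2 * q ξ)) := by
    simp only [hS]
    rw [integral_add iTU (integrable_finsetSum _ fun j _ => iV j), integral_add iT iU,
      integral_add (iρ.const_mul _) (iζq.const_mul _), integral_finsetSum _ fun j _ => iV j]
    have : ∀ j, ∫ ξ, (a * ‖σ j ξ‖ ^ 2 + (b * ‖ζ ξ‖ ^ 2 + c * (‖ζ ξ‖ ^ 2 * q ξ))) =
        a * (∫ x, g j x ^ 2) + (b * (∫ x, f₀ x ^ 2) + c * ∫ ξ, ‖ζ ξ‖ ^ 2 * q ξ) := fun j => by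
      rw [integral_add ((iσ j).const_mul _) iB,
        integral_add (iζ.const_mul _) (iζq.const_mul _)]
      simp only [integral_const_mul, pσ, pζ]
    simp only [this, integral_const_mul, pζρ, pρ]
  have if0 : Integrable fun x => f₀ x ^ 2 := hf₀2.integrable_sq
  have if1 : Integrable fun x => f₁ x ^ 2 := hf₁2.integrable_sq
  have if01 : Integrable fun x => f₀ x * f₁ x := hf₀2.integrable_mul hf₁2
  have e1 : ∫ x, f₁ x ^ 2 ≤ A * ∫ x, f₀ x * f₁ x := by
    rw [← integral_const_mul]
    exact integral_mono_ae if1 (if01.const_mul _) hf₁A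
  have e2 : ∀ j, ∫ x, g j x ^ 2 ≤ Q * ∫ x, f₀ x ^ 2 := fun j => by
    rw [← integral_const_mul]
    exact integral_mono_ae (hg2 j).integrable_sq (if0.const_mul _) (hgQ j)
  have e3 : d * (a * Q + b) * ∫ x, f₀ x ^ 2 ≤ ∫ x, f₀ x * f₁ x := by
    rw [← integral_const_mul]
    exact integral_mono_ae (if0.const_mul _) if01 hab
  have e4 : ∑ j, (a * (∫ x, g j x ^ 2) + (b * (∫ x, f₀ x ^ 2) + c * ∫ ξ, ‖ζ ξ‖ ^ 2 * q ξ)) ≤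
      d * ((a * Q + b) * (∫ x, f₀ x ^ 2) + c * ∫ ξ, ‖ζ ξ‖ ^ 2 * q ξ) := by
    refine (Finset.sum_le_card_nsmul Finset.univ _
      ((a * Q + b) * (∫ x, f₀ x ^ 2) + c * ∫ ξ, ‖ζ ξ‖ ^ 2 * q ξ) fun j _ => ?_).trans
        (le_of_eq (by rw [Finset.card_univ, Fintype.card_fin, nsmul_eq_mul]))
    nlinarith [mul_le_mul_of_nonneg_left (e2 j) ha]
  have e5 : A⁻¹ * ∫ x, f₁ x ^ 2 ≤ ∫ x, f₀ x * f₁ x := by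
    rw [inv_mul_le_iff₀ hA]
    exact e1
  -- Of the available -2∫ f₀f₁, one copy pays for A⁻¹∫ f₁² (`e5`), the other for the unweighted
  -- drift terms (`e3`, `e4`); only multiples of the energy remain.
  calc _ ≤ ∫ ξ, S ξ := by
        exact integral_mono hint hSi hle
    _ ≤ _ := by
        rw [hSint]
        linarith [e3, e4, e5]

end EnergyRate

/-! ### Uniqueness in the tensor formulation. -/

section Uniqueness

variable {d : ℕ} {T : ℝ} {Ψ : ℝ → ℝ} {μ : Measure ℝ}
  {w w₀ w₁ : ℝ × EuclideanSpace ℝ (Fin d) → ℝ} {v : Fin d → ℝ × EuclideanSpace ℝ (Fin d) → ℝ}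

theorem stronglyMeasurable_spaceFourierInv (hw : StronglyMeasurable w) :
    StronglyMeasurable fun p : ℝ × EuclideanSpace ℝ (Fin d) => spaceFourierInv w p.1 p.2 := by
  simp only [spaceFourierInv, fourierInv_eq_integral_planeWave]
  refine StronglyMeasurable.integral_prod_right' (f := fun q :
    (ℝ × EuclideanSpace ℝ (Fin d)) × EuclideanSpace ℝ (Fin d) =>
      planeWave q.1.2 q.2 * (w (q.1.1, q.2) : ℂ)) ?_
  refine StronglyMeasurable.mul ?_ ?_
  · exact (continuous_planeWave.comp (by fun_prop : Continuous fun q :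
      (ℝ × EuclideanSpace ℝ (Fin d)) × EuclideanSpace ℝ (Fin d) =>
        (q.1.2, q.2))).stronglyMeasurable
  · exact Complex.continuous_ofReal.comp_stronglyMeasurable
      (hw.comp_measurable (by fun_prop))

theorem stronglyMeasurable_modeRate
    (hΨc : Continuous fun ξ : EuclideanSpace ℝ (Fin d) => Ψ ((2 * Real.pi * ‖ξ‖) ^ 2))
    (hw₁ : StronglyMeasurable w₁) (hv : ∀ j, StronglyMeasurable (v j)) :
    StronglyMeasurable fun p : ℝ × EuclideanSpace ℝ (Fin d) => modeRate Ψ w₁ v p.1 p.2 := by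
  refine StronglyMeasurable.add (StronglyMeasurable.neg (StronglyMeasurable.mul
    (Continuous.stronglyMeasurable ?_) (stronglyMeasurable_spaceFourierInv hw₁)))
    (Finset.stronglyMeasurable_fun_sum _ fun j _ => StronglyMeasurable.mul
      (Continuous.stronglyMeasurable ?_) (stronglyMeasurable_spaceFourierInv (hv j)))
  · exact Complex.continuous_ofReal.comp (hΨc.comp continuous_snd)
  · fun_prop

theorem stronglyMeasurable_primitive {f : ℝ × EuclideanSpace ℝ (Fin d) → ℂ}
    (hf : StronglyMeasurable f) :
    StronglyMeasurable fun p : ℝ × EuclideanSpace ℝ (Fin d) => ∫ s in Ioo 0 p.1, f (s, p.2) := by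
  have hm : MeasurableSet {q : (ℝ × EuclideanSpace ℝ (Fin d)) × ℝ | 0 < q.2 ∧ q.2 < q.1.1} :=
    (measurableSet_lt measurable_const measurable_snd).inter
      (measurableSet_lt measurable_snd (by fun_prop))
  have h := ((hf.comp_measurable (by fun_prop : Measurable fun q :
    (ℝ × EuclideanSpace ℝ (Fin d)) × ℝ => (q.2, q.1.2))).indicator hm).integral_prod_right'
      (ν := (volume : Measure ℝ))
  convert h using 2 with p
  rw [← integral_indicator measurableSet_Ioo]
  rfl

theorem ae_integrable_slice (hw : Integrable w (spaceTimeMeasure d T))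
    (hw2 : MemLp w 2 (spaceTimeMeasure d T)) :
    ∀ᵐ t ∂(volume.restrict (Ioo 0 T)),
      Integrable (fun x => w (t, x)) ∧ MemLp (fun x => w (t, x)) 2 := by
  have h2 := hw2.integrable_sq
  rw [spaceTimeMeasure_eq_prod] at hw h2
  filter_upwards [hw.prod_right_ae, h2.prod_right_ae] with t h1 h3
  exact ⟨h1, (memLp_two_iff_integrable_sq h1.1).2 h3⟩

theorem integral_norm_sq_spaceFourierInv {t : ℝ} (h1 : Integrable fun x => w (t, x))
    (h2 : MemLp (fun x => w (t, x)) 2) :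
    ∫ ξ, ‖spaceFourierInv w t ξ‖ ^ 2 = ∫ x, w (t, x) ^ 2 := by
  have c1 : Integrable fun x => (w (t, x) : ℂ) := h1.ofReal
  have c2 : MemLp (fun x => (w (t, x) : ℂ)) 2 := h2.ofReal
  simpa [spaceFourierInv] using integral_norm_sq_fourierInv c1 c2

theorem memLp_two_spaceFourierInv_slice {t : ℝ} (h1 : Integrable fun x => w (t, x))
    (h2 : MemLp (fun x => w (t, x)) 2) : MemLp (fun ξ => spaceFourierInv w t ξ) 2 := by
  have c1 : Integrable fun x => (w (t, x) : ℂ) := h1.ofReal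
  have c2 : MemLp (fun x => (w (t, x) : ℂ)) 2 := h2.ofReal
  exact memLp_two_fourierInv c1 c2

theorem memLp_two_spaceFourierInv (hwm : StronglyMeasurable w)
    (hw : Integrable w (spaceTimeMeasure d T)) (hw2 : MemLp w 2 (spaceTimeMeasure d T)) :
    MemLp (fun p : ℝ × EuclideanSpace ℝ (Fin d) => spaceFourierInv w p.1 p.2) 2
      (spaceTimeMeasure d T) := by
  have hm := stronglyMeasurable_spaceFourierInv hwm
  rw [memLp_two_iff_integrable_sq_norm hm.aestronglyMeasurable]
  have hs := ae_integrable_slice hw hw2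
  have h2 := hw2.integrable_sq
  rw [spaceTimeMeasure_eq_prod] at h2 ⊢
  refine (integrable_prod_iff (hm.norm.pow 2).aestronglyMeasurable).2 ⟨?_, ?_⟩
  · filter_upwards [hs] with t ht
    exact (memLp_two_spaceFourierInv_slice ht.1 ht.2).integrable_norm_pow two_ne_zero
  · refine h2.integral_prod_left.congr ?_
    filter_upwards [hs] with t ht
    rw [← integral_norm_sq_spaceFourierInv ht.1 ht.2]
    exact integral_congr_ae (ae_of_all _ fun ξ => by simp)

/-- With η = 1 the growth bound gives |2πξ|² ≤ (1+K)²(1+Ψ)², so a first derivative divided by 1+Ψ is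
a bounded multiplier. -/
theorem exists_coord_mul_inv_le {s C : ℝ} (hs : 1 / 2 < s) (hC : 0 < C)
    (hΨ : ∀ r, 0 ≤ r → 0 ≤ Ψ r) (hΨC : ∀ r : ℝ, 0 ≤ r → C * r ^ s ≤ Ψ r) :
    ∃ M : ℝ, ∀ (ξ : EuclideanSpace ℝ (Fin d)) (j : Fin d),
      |2 * Real.pi * ξ j| * (1 + Ψ ((2 * Real.pi * ‖ξ‖) ^ 2))⁻¹ ≤ M := by
  obtain ⟨K, hK0, hK⟩ := exists_le_sq_add_of_rpow_le hs hC hΨ hΨC one_pos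
  refine ⟨1 + K, fun ξ j => ?_⟩
  set r := (2 * Real.pi * ‖ξ‖) ^ 2 with hr
  have hr0 : 0 ≤ r := by positivity
  have hΨr := hΨ r hr0
  have hp : 0 < 1 + Ψ r := by linarith
  rw [mul_inv_le_iff₀ hp]
  refine abs_le_of_sq_le_sq ((sq_two_pi_mul_coord_le ξ j).trans ((hK r hr0).trans ?_))
    (by positivity)
  nlinarith [mul_nonneg hK0 hΨr, mul_nonneg hK0 (mul_nonneg hΨr hΨr), mul_nonneg hK0 hK0,
    sq_nonneg (K * (1 + Ψ r))]

/-- The weight q compensates both unbounded symbols: Ψq ≤ 1 and |2πξ_j|q ≤ M. Paired with ẑ ∈ L²,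
this makes the energy rate integrable in (t,ξ). -/
theorem memLp_two_modeRate_mul {s C : ℝ} (hs : 1 / 2 < s) (hC : 0 < C)
    (hΨ : ∀ r, 0 ≤ r → 0 ≤ Ψ r) (hΨC : ∀ r : ℝ, 0 ≤ r → C * r ^ s ≤ Ψ r)
    (hΨc : Continuous fun ξ : EuclideanSpace ℝ (Fin d) => Ψ ((2 * Real.pi * ‖ξ‖) ^ 2))
    (hwm₁ : StronglyMeasurable w₁) (hvm : ∀ j, StronglyMeasurable (v j))
    (hw₁ : Integrable w₁ (spaceTimeMeasure d T)) (hw₁2 : MemLp w₁ 2 (spaceTimeMeasure d T))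
    (hv : ∀ j, Integrable (v j) (spaceTimeMeasure d T))
    (hv2 : ∀ j, MemLp (v j) 2 (spaceTimeMeasure d T)) :
    MemLp (fun p : ℝ × EuclideanSpace ℝ (Fin d) =>
      modeRate Ψ w₁ v p.1 p.2 * (((1 + Ψ ((2 * Real.pi * ‖p.2‖) ^ 2))⁻¹ : ℝ) : ℂ)) 2
      (spaceTimeMeasure d T) := by
  obtain ⟨M, hM⟩ := exists_coord_mul_inv_le (d := d) hs hC hΨ hΨC
  have hΨξ : ∀ ξ : EuclideanSpace ℝ (Fin d), 0 ≤ Ψ ((2 * Real.pi * ‖ξ‖) ^ 2) := fun ξ =>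
    hΨ _ (by positivity)
  have hqc : Continuous fun p : ℝ × EuclideanSpace ℝ (Fin d) =>
      (((1 + Ψ ((2 * Real.pi * ‖p.2‖) ^ 2))⁻¹ : ℝ) : ℂ) :=
    Complex.continuous_ofReal.comp (((continuous_const.add hΨc).inv₀ fun ξ =>
      (by linarith [hΨξ ξ] : (0 : ℝ) < 1 + Ψ ((2 * Real.pi * ‖ξ‖) ^ 2)).ne').comp continuous_snd)
  have hPc : Continuous fun p : ℝ × EuclideanSpace ℝ (Fin d) =>
      (Ψ ((2 * Real.pi * ‖p.2‖) ^ 2) : ℂ) :=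
    Complex.continuous_ofReal.comp (hΨc.comp continuous_snd)
  have h1 : MemLp (fun p : ℝ × EuclideanSpace ℝ (Fin d) =>
      (Ψ ((2 * Real.pi * ‖p.2‖) ^ 2) : ℂ) *
        (((1 + Ψ ((2 * Real.pi * ‖p.2‖) ^ 2))⁻¹ : ℝ) : ℂ) * spaceFourierInv w₁ p.1 p.2) 2
      (spaceTimeMeasure d T) := by
    refine (memLp_two_spaceFourierInv hwm₁ hw₁ hw₁2).of_le_mul (c := 1)
      ((hPc.mul hqc).aestronglyMeasurable.mul
        (stronglyMeasurable_spaceFourierInv hwm₁).aestronglyMeasurable) (ae_of_all _ fun p => ?_)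
    rw [norm_mul, ← Complex.ofReal_mul, Complex.norm_real, Real.norm_of_nonneg
      (mul_nonneg (hΨξ _) (inv_nonneg.2 (by linarith [hΨξ p.2])))]
    refine mul_le_mul_of_nonneg_right ?_ (norm_nonneg _)
    exact mul_inv_le_one_of_le₀ (by linarith) (by linarith [hΨξ p.2])
  have h2 : ∀ j, MemLp (fun p : ℝ × EuclideanSpace ℝ (Fin d) =>
      ((2 * Real.pi * p.2 j : ℝ) : ℂ) * Complex.I *
        (((1 + Ψ ((2 * Real.pi * ‖p.2‖) ^ 2))⁻¹ : ℝ) : ℂ) * spaceFourierInv (v j) p.1 p.2) 2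
      (spaceTimeMeasure d T) := fun j => by
    refine (memLp_two_spaceFourierInv (hvm j) (hv j) (hv2 j)).of_le_mul (c := M)
      ((Continuous.aestronglyMeasurable (Continuous.mul (by fun_prop) hqc)).mul
        (stronglyMeasurable_spaceFourierInv (hvm j)).aestronglyMeasurable)
      (ae_of_all _ fun p => ?_)
    rw [norm_mul, norm_mul, norm_mul, Complex.norm_I, mul_one, Complex.norm_real,
      Complex.norm_real, Real.norm_of_nonneg (inv_nonneg.2 (by linarith [hΨξ p.2])),
      Real.norm_eq_abs]
    exact mul_le_mul_of_nonneg_right (hM p.2 j) (norm_nonneg _)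
  refine (h1.neg.add (memLp_finsetSum Finset.univ fun j _ => h2 j)).ae_eq
    (ae_of_all _ fun p => ?_)
  simp only [modeRate, Pi.add_apply, Pi.neg_apply, add_mul, Finset.sum_mul]
  congr 1
  · ring
  · exact Finset.sum_congr rfl fun j _ => by ring

/-- Uniqueness for the tensor formulation under an absorption condition on the first order
terms. -/
theorem IsTensorSolution.ae_eq_zero (h : IsTensorSolution T Ψ w₀ w₁ v) (hT : 0 < T)
    (hΨ : IsBernsteinFunction Ψ) (hμ : HasLevyKhintchineRepr Ψ 0 0 μ) {s C : ℝ} (hs : 1 / 2 < s)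
    (hC : 0 < C) (hΨC : ∀ r : ℝ, 0 ≤ r → C * r ^ s ≤ Ψ r)
    (hwm₀ : StronglyMeasurable w₀) (hwm₁ : StronglyMeasurable w₁)
    (hvm : ∀ j, StronglyMeasurable (v j))
    (hw₀ : Integrable w₀ (spaceTimeMeasure d T)) (hw₀2 : MemLp w₀ 2 (spaceTimeMeasure d T))
    (hw₁ : Integrable w₁ (spaceTimeMeasure d T)) (hw₁2 : MemLp w₁ 2 (spaceTimeMeasure d T))
    (hv : ∀ j, Integrable (v j) (spaceTimeMeasure d T))
    (hv2 : ∀ j, MemLp (v j) 2 (spaceTimeMeasure d T)) {A Q a b c : ℝ} (hA : 0 < A)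
    (ha : 0 ≤ a) (hc : 0 ≤ c)
    (hwA : ∀ᵐ p ∂(spaceTimeMeasure d T), w₁ p ^ 2 ≤ A * (w₀ p * w₁ p))
    (hvQ : ∀ j, ∀ᵐ p ∂(spaceTimeMeasure d T), v j p ^ 2 ≤ Q * w₀ p ^ 2)
    (hab : ∀ᵐ p ∂(spaceTimeMeasure d T), d * (a * Q + b) * w₀ p ^ 2 ≤ w₀ p * w₁ p)
    (hbd : ∀ t ξ j, 2 * (starRingEnd ℂ (spaceFourierInv w₀ t ξ) *
        (((2 * Real.pi * ξ j : ℝ) : ℂ) * Complex.I * spaceFourierInv (v j) t ξ)).re *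
        (1 + Ψ ((2 * Real.pi * ‖ξ‖) ^ 2))⁻¹ ≤
      a * ‖spaceFourierInv (v j) t ξ‖ ^ 2 +
        (b + c * (1 + Ψ ((2 * Real.pi * ‖ξ‖) ^ 2))⁻¹) * ‖spaceFourierInv w₀ t ξ‖ ^ 2) :
    w₀ =ᵐ[spaceTimeMeasure d T] 0 := by
  have hΨ0 := hΨ.nonneg
  have hΨc : Continuous fun ξ : EuclideanSpace ℝ (Fin d) => Ψ ((2 * Real.pi * ‖ξ‖) ^ 2) :=
    hΨ.continuous_symbol
  set q : EuclideanSpace ℝ (Fin d) → ℝ := fun ξ => (1 + Ψ ((2 * Real.pi * ‖ξ‖) ^ 2))⁻¹ with hq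
  have hp : ∀ ξ : EuclideanSpace ℝ (Fin d), 0 < 1 + Ψ ((2 * Real.pi * ‖ξ‖) ^ 2) := fun ξ => by
    linarith [hΨ0 ((2 * Real.pi * ‖ξ‖) ^ 2) (by positivity)]
  have hq0 : ∀ ξ, 0 < q ξ := fun ξ => inv_pos.2 (hp ξ)
  have hprim := fun ξ => h.spaceFourierInv_eq_primitive hT hΨ hμ hw₀ hw₁ hv ξ
  have hζm := stronglyMeasurable_spaceFourierInv hwm₀
  have hRm := stronglyMeasurable_modeRate hΨc hwm₁ hvm
  have hZm := stronglyMeasurable_primitive hRm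
  -- Joint measurability allows the quantifiers to be exchanged, since the exceptional times depend
  -- on ξ.
  have hprim' : ∀ᵐ t ∂(volume.restrict (Ioo 0 T)), ∀ᵐ ξ : EuclideanSpace ℝ (Fin d),
      spaceFourierInv w₀ t ξ = ∫ s in Ioo 0 t, modeRate Ψ w₁ v s ξ := by
    have hmeas : MeasurableSet {p : ℝ × EuclideanSpace ℝ (Fin d) |
        spaceFourierInv w₀ p.1 p.2 = ∫ s in Ioo 0 p.1, modeRate Ψ w₁ v s p.2} :=
      measurableSet_eq_fun hζm.measurable hZm.measurable
    exact (Measure.ae_ae_comm hmeas).2 (ae_of_all _ hprim)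
  set G : ℝ × EuclideanSpace ℝ (Fin d) → ℝ := fun p =>
    2 * (starRingEnd ℂ (spaceFourierInv w₀ p.1 p.2) * modeRate Ψ w₁ v p.1 p.2).re * q p.2 with hG
  have hGi : Integrable G ((volume.restrict (Ioo 0 T)).prod volume) := by
    have h1 : Integrable (fun p : ℝ × EuclideanSpace ℝ (Fin d) =>
        starRingEnd ℂ (spaceFourierInv w₀ p.1 p.2) * (modeRate Ψ w₁ v p.1 p.2 * ((q p.2 : ℝ) : ℂ)))
        (spaceTimeMeasure d T) :=
      (memLp_two_spaceFourierInv hwm₀ hw₀ hw₀2).star.integrable_mul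
        (memLp_two_modeRate_mul hs hC hΨ0 hΨC hΨc hwm₁ hvm hw₁ hw₁2 hv hv2)
    rw [spaceTimeMeasure_eq_prod] at h1
    refine (h1.re.const_mul 2).congr (ae_of_all _ fun p => ?_)
    change 2 * (starRingEnd ℂ (spaceFourierInv w₀ p.1 p.2) *
      (modeRate Ψ w₁ v p.1 p.2 * ((q p.2 : ℝ) : ℂ))).re = 2 * (starRingEnd ℂ
        (spaceFourierInv w₀ p.1 p.2) * modeRate Ψ w₁ v p.1 p.2).re * q p.2
    rw [← mul_assoc, Complex.re_mul_ofReal, mul_assoc]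
  have hγi : IntegrableOn (fun t => ∫ ξ, G (t, ξ)) (Ioo 0 T) := hGi.integral_prod_left
  set E : ℝ → ℝ := fun t => ∫ ξ, ‖spaceFourierInv w₀ t ξ‖ ^ 2 * q ξ with hE
  have hE0 : ∀ t, 0 ≤ E t := fun t => integral_nonneg fun ξ =>
    mul_nonneg (sq_nonneg _) (hq0 ξ).le
  -- The formula for |primitive|² is applied mode by mode, multiplied by q and integrated in ξ;
  -- Fubini then exchanges the s and ξ integrals.
  have hEprim : ∀ᵐ t ∂(volume.restrict (Ioo 0 T)), E t = ∫ s in Ioo 0 t, ∫ ξ, G (s, ξ) := by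
    filter_upwards [hprim', ae_restrict_mem measurableSet_Ioo] with t ht htT
    have hsub : Ioo 0 t ⊆ Ioo 0 T := Ioo_subset_Ioo_right htT.2.le
    have hGt : Integrable G ((volume.restrict (Ioo 0 t)).prod volume) :=
      hGi.mono_measure (Measure.prod_mono (Measure.restrict_mono_set _ hsub) le_rfl)
    rw [integral_integral_swap hGt]
    refine integral_congr_ae ?_
    filter_upwards [ht] with ξ hξ
    rw [hξ, norm_sq_primitive ((integrableOn_modeRate hw₁ hv ξ).mono_set hsub),
      ← integral_mul_const]
    refine integral_congr_ae ?_
    filter_upwards [ae_restrict_of_ae_restrict_of_subset hsub (hprim ξ)] with r hr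
    simp only [hG]
    rw [hr]
  have hs₀ := ae_integrable_slice hw₀ hw₀2
  have hle : ∀ᵐ t ∂(volume.restrict (Ioo 0 T)), ∫ ξ, G (t, ξ) ≤ (A + d * c) * E t := by
    have hs₁ := ae_integrable_slice hw₁ hw₁2
    have hsv := ae_all_iff.2 fun j => ae_integrable_slice (hv j) (hv2 j)
    have hvQ' := ae_all_iff.2 hvQ
    rw [spaceTimeMeasure_eq_prod] at hwA hvQ' hab
    filter_upwards [hs₀, hs₁, hsv, Measure.ae_ae_of_ae_prod hwA, Measure.ae_ae_of_ae_prod hvQ',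
      Measure.ae_ae_of_ae_prod hab, hGi.prod_right_ae] with t i0 i1 iv k1 k2 k3 k4
    exact integral_two_mul_re_conj_mul_rate_le hΨ0 hΨc i0.1 i0.2 i1.1 i1.2 (fun j => (iv j).1)
      (fun j => (iv j).2) hA ha k1 (ae_all_iff.1 k2) k3 (hbd t) k4
  have hE00 := ae_eq_zero_of_eq_primitive_of_le (by positivity) hγi hEprim hE0 hle
  have hfin : ∀ᵐ t ∂(volume.restrict (Ioo 0 T)), ∀ᵐ x, w₀ (t, x) = 0 := by
    have hqc : Continuous q := (continuous_const.add hΨc).inv₀ fun ξ => (hp ξ).ne'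
    filter_upwards [hE00, hs₀] with t ht i0
    have iζ : Integrable fun ξ => ‖spaceFourierInv w₀ t ξ‖ ^ 2 :=
      (memLp_two_spaceFourierInv_slice i0.1 i0.2).integrable_norm_pow two_ne_zero
    have iζq : Integrable fun ξ => ‖spaceFourierInv w₀ t ξ‖ ^ 2 * q ξ := by
      refine iζ.mul_bdd (c := 1) hqc.aestronglyMeasurable (ae_of_all _ fun ξ => ?_)
      rw [Real.norm_of_nonneg (hq0 ξ).le]
      exact inv_le_one_of_one_le₀
        (by linarith [hΨ0 ((2 * Real.pi * ‖ξ‖) ^ 2) (by positivity)])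
    have h1 := (integral_eq_zero_iff_of_nonneg
      (fun ξ => mul_nonneg (sq_nonneg _) (hq0 ξ).le) iζq).1 ht
    have h2 : ∫ x, w₀ (t, x) ^ 2 = 0 := by
      rw [← integral_norm_sq_spaceFourierInv i0.1 i0.2]
      refine integral_eq_zero_of_ae ?_
      filter_upwards [h1] with ξ hξ
      exact (mul_eq_zero.1 hξ).resolve_right (hq0 ξ).ne'
    have h3 := (integral_eq_zero_iff_of_nonneg (fun x => sq_nonneg _) i0.2.integrable_sq).1 h2
    filter_upwards [h3] with x hx
    exact pow_eq_zero_iff two_ne_zero |>.1 hx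
  rw [spaceTimeMeasure_eq_prod]
  exact (Measure.ae_prod_iff_ae_ae (measurableSet_eq_fun hwm₀.measurable measurable_const)).2 hfin

end Uniqueness

/-! ### Bounds for β(r)/r. -/

section QuotientBounds

variable {β : ℝ → ℝ}

/-- Mean value theorem between 0 and r; the convention at r = 0 is consistent with it. -/
theorem exists_divSelf_eq_deriv (hβ : Differentiable ℝ β) (hβ0 : β 0 = 0) {M r : ℝ}
    (hr : |r| ≤ M) : ∃ c ∈ Icc (-M) M, divSelf β r = deriv β c := by
  obtain ⟨h1, h2⟩ := abs_le.1 hr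
  rcases lt_trichotomy r 0 with h | rfl | h
  · obtain ⟨c, hc, e⟩ := exists_deriv_eq_slope β h hβ.continuous.continuousOn
      hβ.differentiableOn
    refine ⟨c, ⟨h1.trans hc.1.le, hc.2.le.trans ((abs_nonneg r).trans hr)⟩, ?_⟩
    rw [e, divSelf, if_neg h.ne, hβ0, zero_sub, zero_sub, neg_div_neg_eq]
  · exact ⟨0, ⟨h1, h2⟩, by simp [divSelf]⟩
  · obtain ⟨c, hc, e⟩ := exists_deriv_eq_slope β h hβ.continuous.continuousOn
      hβ.differentiableOn
    refine ⟨c, ⟨by linarith [hc.1], hc.2.le.trans h2⟩, ?_⟩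
    rw [e, divSelf, if_neg h.ne', hβ0, sub_zero, sub_zero]

theorem exists_divSelf_bounds (hβ : ContDiff ℝ 1 β) (hβ0 : β 0 = 0) (h0 : ∀ r, 0 ≤ deriv β r)
    {M : ℝ} (hM : 0 ≤ M) :
    ∃ α A : ℝ, 0 ≤ α ∧ 0 < A ∧ ((∀ r, 0 < deriv β r) → 0 < α) ∧
      ∀ r, |r| ≤ M → α ≤ divSelf β r ∧ divSelf β r ≤ A := by
  have hd := hβ.continuous_deriv le_rfl
  have hne : (Icc (-M) M).Nonempty := nonempty_Icc.2 (by linarith)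
  obtain ⟨p, -, hp⟩ := isCompact_Icc.exists_isMinOn hne hd.continuousOn
  obtain ⟨r, -, hr⟩ := isCompact_Icc.exists_isMaxOn hne hd.continuousOn
  -- The added 1 keeps A positive even if β' vanishes on the whole interval.
  refine ⟨deriv β p, deriv β r + 1, h0 p, by linarith [h0 r], fun h => h p, fun y hy => ?_⟩
  obtain ⟨c, hc, e⟩ := exists_divSelf_eq_deriv (hβ.differentiable (by simp)) hβ0 hy
  rw [e]
  exact ⟨hp hc, (hr hc : deriv β c ≤ deriv β r).trans (by linarith)⟩

theorem measurable_divSelf (hβ : Measurable β) : Measurable (divSelf β) :=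
  Measurable.ite (measurableSet_singleton 0) measurable_const (hβ.div measurable_id)

end QuotientBounds

/-! ### Products of essentially bounded functions. -/

section EssentialBounds

variable {α E : Type*} {mα : MeasurableSpace α} {ν : Measure α} [NormedAddCommGroup E]

theorem MeasureTheory.MemLp.exists_ae_norm_le {f : α → E} (hf : MemLp f ∞ ν) :
    ∃ M : ℝ, 0 ≤ M ∧ ∀ᵐ x ∂ν, ‖f x‖ ≤ M := by
  refine ⟨(eLpNormEssSup f ν).toReal, ENNReal.toReal_nonneg, ?_⟩
  have h : eLpNormEssSup f ν ≠ ∞ := by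
    rw [← eLpNorm_exponent_top]
    exact hf.2.ne
  filter_upwards [ae_le_eLpNormEssSup (f := f) (μ := ν)] with x hx
  rw [← toReal_enorm]
  exact ENNReal.toReal_mono h hx

theorem MeasureTheory.MemLp.integrable_top_mul {f g : α → ℝ} (hf : MemLp f ∞ ν)
    (hg : Integrable g ν) : Integrable (fun x => f x * g x) ν := by
  obtain ⟨M, -, hM⟩ := hf.exists_ae_norm_le
  exact hg.bdd_mul hf.1 hM

theorem MeasureTheory.MemLp.top_mul_top {f g : α → ℝ} (hf : MemLp f ∞ ν) (hg : MemLp g ∞ ν) :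
    MemLp (fun x => f x * g x) ∞ ν := by
  obtain ⟨M, hM0, hM⟩ := hf.exists_ae_norm_le
  obtain ⟨N, -, hN⟩ := hg.exists_ae_norm_le
  refine memLp_top_of_bound (hf.1.mul hg.1) (M * N) ?_
  filter_upwards [hM, hN] with x h1 h2
  rw [norm_mul]
  exact mul_le_mul h1 h2 (norm_nonneg _) hM0

theorem MeasureTheory.MemLp.memLp_two_of_integrable {f : α → ℝ} (hf : MemLp f ∞ ν)
    (hf1 : Integrable f ν) : MemLp f 2 ν := by
  refine (memLp_two_iff_integrable_sq hf.1).2 ?_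
  simpa only [sq] using hf.integrable_top_mul hf1

theorem memLp_top_comp_continuous {f : ℝ → ℝ} (hf : Continuous f) {u : α → ℝ}
    (hu : MemLp u ∞ ν) : MemLp (fun x => f (u x)) ∞ ν := by
  obtain ⟨M, hM0, hM⟩ := hu.exists_ae_norm_le
  obtain ⟨B, hB⟩ := isCompact_Icc.exists_bound_of_continuousOn
    (hf.continuousOn (s := Icc (-M) M))
  refine memLp_top_of_bound (hf.comp_aestronglyMeasurable hu.1) B ?_
  filter_upwards [hM] with x hx
  exact hB _ (abs_le.1 hx)

end EssentialBounds

/-! ### The equation for the difference of two solutions. -/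

section Difference

variable {d : ℕ} {T : ℝ} {Ψ : ℝ → ℝ} {μ : Measure ℝ}

theorem isTestFunction_mul {χ : ℝ → ℝ} {ψ : EuclideanSpace ℝ (Fin d) → ℝ}
    (hχ : ContDiff ℝ (⊤ : ℕ∞) χ) (hχs : HasCompactSupport χ) (hχT : tsupport χ ⊆ Iio T)
    (hψ : ContDiff ℝ (⊤ : ℕ∞) ψ) (hψs : HasCompactSupport ψ) :
    IsTestFunction T fun p : ℝ × EuclideanSpace ℝ (Fin d) => χ p.1 * ψ p.2 := by
  have hsub : tsupport (fun p : ℝ × EuclideanSpace ℝ (Fin d) => χ p.1 * ψ p.2) ⊆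
      tsupport χ ×ˢ tsupport ψ := by
    refine closure_minimal (fun p hp => ?_)
      ((isClosed_tsupport χ).prod (isClosed_tsupport ψ))
    exact ⟨subset_tsupport _ (left_ne_zero_of_mul hp), subset_tsupport _
      (right_ne_zero_of_mul hp)⟩
  exact ⟨(hχ.comp contDiff_fst).mul (hψ.comp contDiff_snd),
    (hχs.isCompact.prod hψs.isCompact).of_isClosed_subset (isClosed_tsupport _) hsub,
    hsub.trans (prod_mono hχT (subset_univ _))⟩

theorem IsTensorSolution.congr {w₀ w₁ w₀' w₁' : ℝ × EuclideanSpace ℝ (Fin d) → ℝ}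
    {v v' : Fin d → ℝ × EuclideanSpace ℝ (Fin d) → ℝ} (h : IsTensorSolution T Ψ w₀ w₁ v)
    (h₀ : w₀ =ᵐ[spaceTimeMeasure d T] w₀') (h₁ : w₁ =ᵐ[spaceTimeMeasure d T] w₁')
    (hv : ∀ j, v j =ᵐ[spaceTimeMeasure d T] v' j) : IsTensorSolution T Ψ w₀' w₁' v' := by
  intro χ ψ hχ hχs hχT hψ hψs
  rw [← h χ ψ hχ hχs hχT hψ hψs]
  refine integral_congr_ae ?_
  filter_upwards [h₀, h₁, ae_all_iff.2 hv] with p e0 e1 ev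
  simp only [e0, e1, ev]

theorem integrable_fst_mul_snd {χ : ℝ → ℝ} {f : EuclideanSpace ℝ (Fin d) → ℝ}
    (hχ : Integrable χ) (hf : Integrable f) :
    Integrable (fun p : ℝ × EuclideanSpace ℝ (Fin d) => χ p.1 * f p.2) (spaceTimeMeasure d T) := by
  rw [spaceTimeMeasure_eq_prod]
  exact hχ.restrict.mul_prod hf

theorem map_eq_sum_coord (L : EuclideanSpace ℝ (Fin d) →L[ℝ] ℝ) (x : EuclideanSpace ℝ (Fin d)) :
    L x = ∑ j, x j * L (EuclideanSpace.single j 1) := by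
  conv_lhs => rw [← (EuclideanSpace.basisFun (Fin d) ℝ).sum_repr x]
  simp [map_sum]

/-- The difference of two solutions solves the homogeneous tensor formulation. -/
theorem isTensorSolution_sub (hμ : HasLevyKhintchineRepr Ψ 0 0 μ)
    {β b : ℝ → ℝ} {D : EuclideanSpace ℝ (Fin d) → EuclideanSpace ℝ (Fin d)}
    {u : ℝ × EuclideanSpace ℝ (Fin d) → ℝ} {u₀ : SignedMeasure (EuclideanSpace ℝ (Fin d))}
    {y₁ y₂ : ℝ × EuclideanSpace ℝ (Fin d) → ℝ}
    (hk : MemLp (fun p => divSelf β (u p)) ∞ (spaceTimeMeasure d T))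
    (hb : MemLp (fun p => b (u p)) ∞ (spaceTimeMeasure d T))
    (hD : ∀ j, MemLp (fun p : ℝ × EuclideanSpace ℝ (Fin d) => D p.2 j) ∞ (spaceTimeMeasure d T))
    (hy₁ : MemLp y₁ ∞ (spaceTimeMeasure d T)) (hy₂ : MemLp y₂ ∞ (spaceTimeMeasure d T))
    (hsol₁ : IsLinearizedSolution T Ψ β b D u u₀ y₁)
    (hsol₂ : IsLinearizedSolution T Ψ β b D u u₀ y₂) :
    IsTensorSolution T Ψ (y₁ - y₂) (fun p => divSelf β (u p) * (y₁ - y₂) p)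
      (fun j p => b (u p) * D p.2 j * (y₁ - y₂) p) := by
  intro χ ψ hχ hχs hχT hψ hψs
  have hφ := isTestFunction_mul hχ hχs hχT hψ hψs
  set F : (ℝ × EuclideanSpace ℝ (Fin d) → ℝ) → ℝ × EuclideanSpace ℝ (Fin d) → ℝ := fun y p =>
    y p * (deriv χ p.1 * ψ p.2) - divSelf β (u p) * y p * (χ p.1 * psiLaplacian Ψ ψ p.2) +
      ∑ j, b (u p) * D p.2 j * y p * (χ p.1 * fderiv ℝ ψ p.2 (EuclideanSpace.single j 1)) with hF
  have hsol : ∀ y, IsLinearizedSolution T Ψ β b D u u₀ y →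
      (∫ p, F y p ∂(spaceTimeMeasure d T)) + ∫ᵛ x, χ 0 * ψ x ∂•u₀ = 0 := fun y hy => by
    refine Eq.trans ?_ (hy _ hφ)
    congr 1
    refine integral_congr_ae (ae_of_all _ fun p => ?_)
    have e1 : deriv (fun τ => χ τ * ψ p.2) p.1 = deriv χ p.1 * ψ p.2 :=
      deriv_mul_const_field _
    have e2 : fderiv ℝ (fun x => χ p.1 * ψ x) p.2 (D p.2) =
        χ p.1 * ∑ j, D p.2 j * fderiv ℝ ψ p.2 (EuclideanSpace.single j 1) := by
      rw [fderiv_const_mul (hψ.differentiable (by simp)).differentiableAt, ← map_eq_sum_coord]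
      rfl
    simp only [hF, e1, e2, psiLaplacian_const_mul, Finset.mul_sum]
    congr 1
    exact Finset.sum_congr rfl fun j _ => by ring
  have hχ' : Continuous (deriv χ) := hχ.continuous_deriv (by simp)
  have hψ' : Continuous (fderiv ℝ ψ) := hψ.continuous_fderiv (by simp)
  have iχ : Integrable χ := hχ.continuous.integrable_of_hasCompactSupport hχs
  have i0 := integrable_fst_mul_snd (T := T) (hχ'.integrable_of_hasCompactSupport hχs.deriv)
    (hψ.continuous.integrable_of_hasCompactSupport hψs)
  have i1 := integrable_fst_mul_snd (T := T) iχ (integrable_psiLaplacian hμ hψ hψs)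
  have i2 := fun j : Fin d => integrable_fst_mul_snd (T := T)
    (f := fun x => fderiv ℝ ψ x (EuclideanSpace.single j 1)) iχ
    ((hψ'.clm_apply continuous_const).integrable_of_hasCompactSupport
      (hψs.fderiv_apply ℝ (EuclideanSpace.single j 1)))
  -- Each solution separately is only bounded, so every test factor, including Ψ(-Δ)ψ, must be in L¹
  -- for the two integrals to be subtracted.
  have hFi : ∀ y, MemLp y ∞ (spaceTimeMeasure d T) →
      Integrable (F y) (spaceTimeMeasure d T) := fun y hy =>
    ((hy.integrable_top_mul i0).sub ((hk.top_mul_top hy).integrable_top_mul i1)).add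
      (integrable_finsetSum _ fun j _ => ((hb.top_mul_top (hD j)).top_mul_top
        hy).integrable_top_mul (i2 j))
  -- Both solutions have the same u₀ term, which cancels without requiring χ(0) = 0.
  have hsub : ∫ p, (F y₁ p - F y₂ p) ∂(spaceTimeMeasure d T) = 0 := by
    rw [integral_sub (hFi _ hy₁) (hFi _ hy₂)]
    linarith [hsol _ hsol₁, hsol _ hsol₂]
  rw [← hsub]
  refine integral_congr_ae (ae_of_all _ fun p => ?_)
  simp only [hF, Pi.sub_apply]
  rw [add_sub_add_comm, ← Finset.sum_sub_distrib]
  congr 1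
  · ring
  · exact Finset.sum_congr rfl fun j _ => by ring

end Difference

/-! ### Conclusion: choice of constants in the two cases. -/

theorem theorem3p2 (d : ℕ) (hd : 2 ≤ d) (T : ℝ) (hT : 0 < T)
    (Ψ : ℝ → ℝ) (hΨ : IsBernsteinFunction Ψ)
    (μ : Measure ℝ) (hμ : HasLevyKhintchineRepr Ψ 0 0 μ)
    (s C : ℝ) (hs : s ∈ Ioo (1 / 2 : ℝ) 1) (hC : 0 < C)
    (hΨC : ∀ r : ℝ, 0 ≤ r → C * r ^ s ≤ Ψ r)
    (β : ℝ → ℝ) (hβ : ContDiff ℝ 1 β) (hβ0 : β 0 = 0)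
    (D : EuclideanSpace ℝ (Fin d) → EuclideanSpace ℝ (Fin d)) (hD : MemLp D ∞ volume)
    (hβD : (∀ r, 0 < deriv β r) ∨ ((∀ r, 0 ≤ deriv β r) ∧ D =ᵐ[volume] 0))
    (b : ℝ → ℝ) (hb : ContDiff ℝ 1 b)
    (u : ℝ × EuclideanSpace ℝ (Fin d) → ℝ) (hu : MemLp u ∞ (spaceTimeMeasure d T))
    (u₀ : SignedMeasure (EuclideanSpace ℝ (Fin d)))
    (y₁ y₂ : ℝ × EuclideanSpace ℝ (Fin d) → ℝ)
    (hy₁ : MemLp y₁ ∞ (spaceTimeMeasure d T)) (hy₂ : MemLp y₂ ∞ (spaceTimeMeasure d T))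
    (hsol₁ : IsLinearizedSolution T Ψ β b D u u₀ y₁)
    (hsol₂ : IsLinearizedSolution T Ψ β b D u u₀ y₂)
    (hL1 : MemLp (y₁ - y₂) 1 (spaceTimeMeasure d T))
    (hL2 : IsEssBoundedInL2 T (y₁ - y₂))
    (hinit : VanishesWeaklyAtZero (y₁ - y₂)) :
    y₁ =ᵐ[spaceTimeMeasure d T] y₂ := by
  obtain ⟨M, hM0, hM⟩ := hu.exists_ae_norm_le
  obtain ⟨α, A, hα0, hA, hα, hαA⟩ := exists_divSelf_bounds hβ hβ0
    (fun r => hβD.elim (fun h => (h r).le) fun h => h.1 r) hM0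
  have hk : MemLp (fun p => divSelf β (u p)) ∞ (spaceTimeMeasure d T) := by
    refine memLp_top_of_bound ((measurable_divSelf
      hβ.continuous.measurable).comp_aemeasurable hu.1.aemeasurable).aestronglyMeasurable A ?_
    filter_upwards [hM] with p hp
    rw [Real.norm_of_nonneg (hα0.trans (hαA _ hp).1)]
    exact (hαA _ hp).2
  have hbu := memLp_top_comp_continuous hb.continuous hu
  have hqmp : Measure.QuasiMeasurePreserving Prod.snd (spaceTimeMeasure d T) volume := by
    rw [spaceTimeMeasure_eq_prod]
    exact Measure.quasiMeasurePreserving_snd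
  have hDj : ∀ j, MemLp (fun p : ℝ × EuclideanSpace ℝ (Fin d) => D p.2 j) ∞
      (spaceTimeMeasure d T) := fun j => by
    obtain ⟨N, -, hN⟩ := hD.exists_ae_norm_le
    refine memLp_top_of_bound ((by fun_prop : Continuous fun x : EuclideanSpace ℝ (Fin d) =>
      x j).comp_aestronglyMeasurable (hD.1.comp_quasiMeasurePreserving hqmp)) N ?_
    filter_upwards [hqmp.ae hN] with p hp
    exact (PiLp.norm_apply_le (D p.2) j).trans hp
  have hz := hy₁.sub hy₂
  have hz1 : Integrable (y₁ - y₂) (spaceTimeMeasure d T) := memLp_one_iff_integrable.1 hL1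
  have hz2 := hz.memLp_two_of_integrable hz1
  have hkz1 := hk.integrable_top_mul hz1
  have hkz2 := (hk.top_mul_top hz).memLp_two_of_integrable hkz1
  have hten := isTensorSolution_sub hμ hk hbu hDj hy₁ hy₂ hsol₁ hsol₂
  -- Strongly measurable representatives are needed, since the uniqueness argument uses joint
  -- measurability of the Fourier transforms in (t,ξ).
  have e₀ := hz1.1.ae_eq_mk
  have e₁ := hkz1.1.ae_eq_mk
  have hwA : ∀ᵐ p ∂(spaceTimeMeasure d T), hkz1.1.mk _ p ^ 2 ≤
      A * (hz1.1.mk _ p * hkz1.1.mk _ p) := by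
    filter_upwards [e₀, e₁, hM] with p h0 h1 hp
    rw [← h0, ← h1]
    obtain ⟨k1, k2⟩ := hαA _ hp
    nlinarith [mul_nonneg (mul_nonneg (hα0.trans k1) (sub_nonneg.2 k2))
      (sq_nonneg ((y₁ - y₂) p))]
  have hwα : ∀ᵐ p ∂(spaceTimeMeasure d T), α * hz1.1.mk _ p ^ 2 ≤
      hz1.1.mk _ p * hkz1.1.mk _ p := by
    filter_upwards [e₀, e₁, hM] with p h0 h1 hp
    rw [← h0, ← h1]
    nlinarith [mul_nonneg (sub_nonneg.2 (hαA _ hp).1) (sq_nonneg ((y₁ - y₂) p))]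
  suffices hmk : hz1.1.mk _ =ᵐ[spaceTimeMeasure d T] 0 by
    filter_upwards [e₀, hmk] with p h0 h1
    exact sub_eq_zero.1 (h0.trans h1)
  rcases hβD with hpos | ⟨-, hD0⟩
  · have hα' := hα hpos
    have hvi := fun j => (hbu.top_mul_top (hDj j)).integrable_top_mul hz1
    have hv2 := fun j => ((hbu.top_mul_top (hDj j)).top_mul_top hz).memLp_two_of_integrable (hvi j)
    have ev := fun j => (hvi j).1.ae_eq_mk
    have hN := fun j => (hbu.top_mul_top (hDj j)).exists_ae_norm_le
    choose N hN0 hN using hN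
    set Q : ℝ := ∑ j, N j ^ 2 with hQ
    have hQ0 : 0 ≤ Q := Finset.sum_nonneg fun j _ => sq_nonneg _
    have hvQ : ∀ j, ∀ᵐ p ∂(spaceTimeMeasure d T), (hvi j).1.mk _ p ^ 2 ≤
        Q * hz1.1.mk _ p ^ 2 := fun j => by
      filter_upwards [e₀, ev j, hN j] with p h0 h1 hp
      rw [← h0, ← h1, mul_pow]
      refine mul_le_mul_of_nonneg_right ?_ (sq_nonneg _)
      rw [← sq_abs]
      exact (pow_le_pow_left₀ (abs_nonneg _) hp 2).trans
        (Finset.single_le_sum (f := fun j => N j ^ 2) (fun i _ => sq_nonneg _)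
          (Finset.mem_univ j))
    -- δ and η are chosen so that δQ and δ⁻¹η are each at most α/(2(d+1)); summed over d coordinates
    -- they stay below α. The shifts d+1 and Q+1 avoid zero denominators.
    set δ : ℝ := α / (2 * (d + 1) * (Q + 1)) with hδ
    have hδ0 : 0 < δ := by positivity
    set η : ℝ := δ * (α / (2 * (d + 1))) with hη
    have hη0 : 0 < η := by positivity
    obtain ⟨K, hK0, hK⟩ := exists_le_sq_add_of_rpow_le hs.1 hC hΨ.nonneg hΨC hη0
    refine (hten.congr e₀ e₁ ev).ae_eq_zero hT hΨ hμ hs.1 hC hΨC hz1.1.stronglyMeasurable_mk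
      hkz1.1.stronglyMeasurable_mk (fun j => (hvi j).1.stronglyMeasurable_mk) (hz1.congr e₀)
      (hz2.ae_eq e₀) (hkz1.congr e₁) (hkz2.ae_eq e₁) (fun j => (hvi j).congr (ev j))
      (fun j => (hv2 j).ae_eq (ev j)) (Q := Q) hA hδ0.le
      (mul_nonneg (inv_nonneg.2 hδ0.le) hK0) hwA hvQ ?_
      fun t ξ j => two_mul_re_conj_mul_coord_div_le hδ0 hΨ.nonneg hK ξ j _ _
    filter_upwards [hwα] with p hp
    refine (mul_le_mul_of_nonneg_right ?_ (sq_nonneg _)).trans hp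
    have h1 : δ⁻¹ * η = α / (2 * (d + 1)) := by rw [hη, inv_mul_cancel_left₀ hδ0.ne']
    have h2 : δ * Q ≤ α / (2 * (d + 1)) := by
      have : δ * (Q + 1) = α / (2 * (d + 1)) := by rw [hδ]; field_simp
      linarith
    have h3 : (d + 1 : ℝ) * (α / (2 * (d + 1)) + α / (2 * (d + 1))) = α := by field_simp; ring
    rw [h1]
    have h4 : (d : ℝ) * (δ * Q + α / (2 * (d + 1))) ≤
        d * (α / (2 * (d + 1)) + α / (2 * (d + 1))) := by gcongr
    have h5 : 0 ≤ α / (2 * ((d : ℝ) + 1)) := by positivity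
    linarith
  -- Degenerate case: the drift vanishes, so all absorption constants are 0 and only 0 ≤ z w is
  -- required.
  · have ev : ∀ j, (fun p : ℝ × EuclideanSpace ℝ (Fin d) => b (u p) * D p.2 j * (y₁ - y₂) p)
        =ᵐ[spaceTimeMeasure d T] fun _ => 0 := fun j => by
      filter_upwards [hqmp.ae hD0] with p hp
      simp [hp]
    refine (hten.congr e₀ e₁ ev).ae_eq_zero hT hΨ hμ hs.1 hC hΨC hz1.1.stronglyMeasurable_mk
      hkz1.1.stronglyMeasurable_mk (fun j => stronglyMeasurable_const) (hz1.congr e₀)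
      (hz2.ae_eq e₀) (hkz1.congr e₁) (hkz2.ae_eq e₁) (fun j => integrable_zero _ _ _)
      (fun j => MemLp.zero) (Q := 0) (a := 0) (b := 0) (c := 0) hA le_rfl le_rfl hwA
      (fun j => by simp) ?_ fun t ξ j => ?_
    · filter_upwards [hwα] with p hp
      simpa using (mul_nonneg hα0 (sq_nonneg _)).trans hp
    · have : spaceFourierInv (fun _ : ℝ × EuclideanSpace ℝ (Fin d) => 0) t ξ = 0 := by
        simp [spaceFourierInv, fourierInv_eq_integral_planeWave]
      simp [this]
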